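/- **Setting.** Inner products are conjugate linear in the first argument. Let $\mathbb F\subseteq\mathbb Z$ be $\{0,1,2,\dots\}$, $\{\dots,-2,-1,0\}$, $\mathbb Z$ or $\{0,\dots,N\}$ with $N\ge 0$. A *bandlimit pair* $(\mathbf t,\mathbf t')$ consists of a strictly increasing real sequence $\mathbf t=(t_n)_{n\in\mathbb F}$ without finite accumulation point and a sequence $\mathbf t'=(t_n')_{n\in\mathbb F}$ of positive numbers with $\sum_n t_n'/(1+t_n^2)<\infty$. $\mathcal S^R(\mathcal H)$ denotes the class of linear transformations $T$ with domain $\mathrm{dom}\,T$ in a separable complex Hilbert space $\mathcal H$ (not necessarily densely defined) which are closed, symmetric, simple (no restriction of $T$ to $\mathrm{dom}\,T\cap S$, with $S$ a non-trivial proper closed subspace, is self-adjoint in $S$), regular ($T-r$ is bounded below on $\mathrm{dom}\,T$ for every $r\in\mathbb R$) and have deficiency indices $(1,1)$, i.e. $\dim\ker(T^*\mp i)=1$, where $T^*$ is the adjoint linear relation if $T$ is not densely defined. Let $(\mathbf t,\mathbf t')$ be a bandlimit pair and let $T_0$ be a self-adjoint operator on a complex Hilbert space $\mathcal H$ with an orthonormal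 basis $(\psi_n)_{n\in\mathbb F}$ of eigenvectors, $T_0\psi_n=t_n\psi_n$. Put $$\phi_\pm=\sum_n\frac{\sqrt{t_n'}}{t_n\mp i}\,\psi_n,\qquad T=T_0|_{\mathrm{dom}\,T},\qquad \mathrm{dom}\,T=\{x\in\mathrm{dom}\,T_0:\ \langle\phi_+,(T_0+i)x\rangle=0\}.$$ Let $V$ be the partial isometry with $V(T+i)x=(T-i)x$ for $x\in\mathrm{dom}\,T$ and $V=0$ on $\mathrm{ran}(T+i)^\perp$. For $\theta\in[0,1)$ let $U_\theta=V+\|\phi_+\|^{-2}e^{2\pi i\theta}\langle\phi_+,\cdot\rangle\phi_-$, and let $T_\theta$ be the inverse Cayley transform of $U_\theta$, with graph $\{(x-U_\theta x,\ i(x+U_\theta x)):x\in\mathcal H\}$ (a self-adjoint extension of $T$; it is a linear relation rather than an operator for the one exceptional $\theta$ that occurs when $T$ is not densely defined). For $s\in\mathbb R$ let $n(s)$ be the index with $t_{n(s)}\le s<t_{n(s)+1}$ (the last index if all $t_n\le s$, and $-1$ if all $t_n>s$), and let $\tau(s)=n(s)+\theta(s)$, where $\theta(s)\in[0,1)$ is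 the parameter for which $s$ is an eigenvalue of $T_{\theta(s)}$; $\tau$ is the phase function of $T$. A *family of eigenvectors* is a family $(\phi_s)_{s\in\mathbb R}$ in which $\phi_s$ is a unit eigenvector of $T_{\theta(s)}$ with eigenvalue $s$. For such a family let $\mathcal K(T)$ be the reproducing kernel Hilbert space of functions $\mathbb R\to\mathbb C$ with kernel $K^T(r,s)=\langle\phi_r,\phi_s\rangle$, and let $K^T_s\in\mathcal K(T)$ be its point evaluation vectors, $\langle K_s^T,F\rangle=F(s)$ for $F\in\mathcal K(T)$. **Theorem.** $T\in\mathcal S^R(\mathcal H)$. There is a family of eigenvectors $(\phi_s)$ for which $K^T$ is real-valued, smooth on $\mathbb R\times\mathbb R$ and given, for $r,s\notin\{t_n\}$, by $$K^T(r,s)=f(r)(-1)^{\lfloor\tau(r)\rfloor}\Big(\sum_k\frac{t_k'}{(r-t_k)(s-t_k)}\Big)(-1)^{\lfloor\tau(s)\rfloor}f(s),\qquad f(s)=\Big(\sum_n\frac{t_n'}{(s-t_n)^2}\Big)^{-1/2}.$$ For this family, and indeed for every family of eigenvectors $(\phi_s)$: 1. there is one and only one bounded linear map $U^T:\mathcal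 H\to\mathcal K(T)$ with $U^T\phi_s=K^T_s$ for all $s\in\mathbb R$, it is an isometry of $\mathcal H$ onto $\mathcal K(T)$, and $(U^Th)(s)=\langle\phi_s,h\rangle$ for all $h\in\mathcal H$, $s\in\mathbb R$; 2. $M^T:=U^TT(U^T)^*$, with domain $U^T\,\mathrm{dom}\,T$, belongs to $\mathcal S^R(\mathcal K(T))$ and acts as multiplication by the independent variable: $(M^TF)(s)=s\,F(s)$ for all $F\in\mathrm{dom}\,M^T$ and $s\in\mathbb R$. In particular $(M^T,\mathcal K(T))$ is a functional model for $T$. -/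

import Mathlib

open scoped ContDiff

noncomputable section

namespace BandlimitModel

/-! ## Bandlimit pairs -/

/-- `(t, t')` is a (time-varying) bandlimit pair with index set `F ⊆ ℤ`. -/
structure IsBandlimitPair (F : Set ℤ) (t t' : F → ℝ) : Prop where
  index : F = Set.Ici 0 ∨ F = Set.Iic 0 ∨ F = Set.univ ∨ ∃ N : ℕ, F = Set.Icc 0 (N : ℤ)
  strictMono : StrictMono t
  no_accPt : ∀ x : ℝ, ¬ AccPt x (Filter.principal (Set.range t))
  pos : ∀ n, 0 < t' n
  summable : Summable fun n => t' n / (1 + t n ^ 2)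

section Operators

variable {H : Type*} [NormedAddCommGroup H] [InnerProductSpace ℂ H]

/-! ## Regular simple symmetric linear transformations with deficiency indices `(1,1)` -/

/-- `ker (T* - z)`, where `T*` is the adjoint of `T` as a linear relation (if `T` is densely
defined this is the graph of the adjoint operator). -/
def deficiencySpace (T : H →ₗ.[ℂ] H) (z : ℂ) : Submodule ℂ H :=
  T.graph.adjoint.comap (LinearMap.id.prod (z • LinearMap.id))

/-- `T` is simple: there is no closed subspace `S`, other than `0` and the whole space, such that
the restriction of `T` to `dom T ∩ S` is a self-adjoint operator in `S`. -/
def IsSimple (T : H →ₗ.[ℂ] H) : Prop :=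
  ∀ (S : Submodule ℂ H) [CompleteSpace S], S ≠ ⊥ → S ≠ ⊤ →
    ¬ ∃ A : S →ₗ.[ℂ] S, IsSelfAdjoint A ∧
      A.graph.map (S.subtype.prodMap S.subtype) = (T.domRestrict S).graph

/-- `T` is regular: `T - r` is bounded below on `dom T` for every real `r`. -/
def IsRegular (T : H →ₗ.[ℂ] H) : Prop :=
  ∀ r : ℝ, ∃ c : ℝ, 0 < c ∧ ∀ x : T.domain, c * ‖(x : H)‖ ≤ ‖T x - (r : ℂ) • (x : H)‖

/-- The class `S^R(H)` of closed, regular, simple, symmetric linear transformations with deficiency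
indices `(1,1)` in a separable Hilbert space `H`; they need not be densely defined. -/
structure IsSR [CompleteSpace H] (T : H →ₗ.[ℂ] H) : Prop where
  separable : TopologicalSpace.SeparableSpace H
  closed : T.IsClosed
  symmetric : T.IsFormalAdjoint T
  simple : IsSimple T
  regular : IsRegular T
  index_plus : Module.finrank ℂ (deficiencySpace T Complex.I) = 1
  index_minus : Module.finrank ℂ (deficiencySpace T (-Complex.I)) = 1

/-! ## The Cayley transform and the extensions `T_θ` -/

/-- The graph of the partial isometry `V = b(T)`, `b(z) = (z - i) / (z + i)`: it maps
`T x + i x` to `T x - i x` for `x ∈ dom T` and vanishes on the orthogonal complement of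
`ran (T + i)`. -/
def cayley (T : H →ₗ.[ℂ] H) : Submodule ℂ (H × H) :=
  T.graph.map
      ((LinearMap.snd ℂ H H + Complex.I • LinearMap.fst ℂ H H).prod
        (LinearMap.snd ℂ H H - Complex.I • LinearMap.fst ℂ H H)) ⊔
    ((T.graph.map (LinearMap.snd ℂ H H + Complex.I • LinearMap.fst ℂ H H))ᗮ).prod ⊥

/-- The graph of `U_θ = V + (e^{2πiθ} / ‖φ₊‖²) ⟨φ₊, ·⟩ φ₋`. -/
def unitaryExt (T : H →ₗ.[ℂ] H) (φp φm : H) (θ : ℝ) : Submodule ℂ (H × H) :=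
  (cayley T).map
    ((LinearMap.fst ℂ H H).prod
      (LinearMap.snd ℂ H H +
        (Complex.exp (2 * Real.pi * Complex.I * θ) / (‖φp‖ : ℂ) ^ 2) •
          ((innerₛₗ ℂ φp).smulRight φm).comp (LinearMap.fst ℂ H H)))

/-- The graph of `T_θ = b⁻¹(U_θ)`, which maps `x - U_θ x` to `i (x + U_θ x)`. If `T` is not densely
defined then `1` is an eigenvalue of `U_θ` for one value of `θ`, and for that value `T_θ` is
a self-adjoint linear relation which is not an operator. -/
def selfAdjointExt (T : H →ₗ.[ℂ] H) (φp φm : H) (θ : ℝ) : Submodule ℂ (H × H) :=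
  (unitaryExt T φp φm θ).map
    ((LinearMap.fst ℂ H H - LinearMap.snd ℂ H H).prod
      (Complex.I • (LinearMap.fst ℂ H H + LinearMap.snd ℂ H H)))

/-- The real eigenvalues of `T_θ`. -/
def realEigenvalues (T : H →ₗ.[ℂ] H) (φp φm : H) (θ : ℝ) : Set ℝ :=
  {s | ∃ v : H, v ≠ 0 ∧ (v, (s : ℂ) • v) ∈ selfAdjointExt T φp φm θ}

/-! ## The symmetric transformation of a bandlimit pair -/

variable {F : Set ℤ}

/-- `φ₊ = ∑ √t'ₙ / (tₙ - i) ψₙ`. -/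
def phiPlus (t t' : F → ℝ) (ψ : HilbertBasis F ℂ H) : H :=
  ∑' n, ((Real.sqrt (t' n) : ℂ) / ((t n : ℂ) - Complex.I)) • ψ n

/-- `φ₋ = ∑ √t'ₙ / (tₙ + i) ψₙ`. -/
def phiMinus (t t' : F → ℝ) (ψ : HilbertBasis F ℂ H) : H :=
  ∑' n, ((Real.sqrt (t' n) : ℂ) / ((t n : ℂ) + Complex.I)) • ψ n

/-- The restriction of `T₀` to `{x ∈ dom T₀ | ⟨φ₊, (T₀ + i) x⟩ = 0}`. -/
def symRestrict (T₀ : H →ₗ.[ℂ] H) (φp : H) : H →ₗ.[ℂ] H :=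
  T₀.domRestrict
    ((LinearMap.ker
      ((innerₛₗ ℂ φp).comp (T₀.toFun + Complex.I • T₀.domain.subtype))).map T₀.domain.subtype)

/-! ## The phase function and the eigenvectors `φ_s` -/

open scoped Classical in
/-- The index `n` with `tₙ ≤ s < tₙ₊₁`; it is the last index if no node lies above `s`, and it is
`-1` if all the nodes lie above `s` (the first index is then `0`). -/
def nodeIndex (t : F → ℝ) (s : ℝ) : ℤ :=
  if ∃ n, t n ≤ s then sSup {n : ℤ | ∃ h : n ∈ F, t ⟨n, h⟩ ≤ s} else -1

/-- The phase function `τ`, the compositional inverse of the spectral function `n + θ ↦ tₙ(θ)`: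
`τ(s) = n + θ` where `tₙ ≤ s < tₙ₊₁` and `θ` is the element of `[0,1)` such that `s` is an
eigenvalue of `T_θ`. -/
def phase (t : F → ℝ) (T : H →ₗ.[ℂ] H) (φp φm : H) (s : ℝ) : ℝ :=
  nodeIndex t s + sInf {θ : ℝ | θ ∈ Set.Ico 0 1 ∧ s ∈ realEigenvalues T φp φm θ}

/-- `φ_s` is, for every real `s`, a normalized eigenvector with eigenvalue `s` of the extension
`T_θ`, where `θ` is the fractional part of `τ(s)`. -/
def IsEigenvectorFamily (t : F → ℝ) (T : H →ₗ.[ℂ] H) (φp φm : H) (φ : ℝ → H) : Prop :=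
  ∀ s : ℝ, ‖φ s‖ = 1 ∧
    (φ s, (s : ℂ) • φ s) ∈ selfAdjointExt T φp φm (Int.fract (phase t T φp φm s))

/-- `f(s) = (∑ t'ₙ / (s - tₙ)²)^(-1/2)`. -/
def weight (t t' : F → ℝ) (s : ℝ) : ℝ :=
  (Real.sqrt (∑' n, t' n / (s - t n) ^ 2))⁻¹

/-- The choice of phases of the eigenvectors `φ_s` for which the kernel `⟨φ_r, φ_s⟩` is smooth and
is given by the explicit formula (the formula is written off the nodes, where it has no vanishing
denominators; its values at the nodes are the limits). -/
structure HasKernelFormula (t t' : F → ℝ) (T : H →ₗ.[ℂ] H) (φp φm : H) (φ : ℝ → H) : Prop where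
  smooth : ContDiff ℝ ∞ fun p : ℝ × ℝ => (inner ℂ (φ p.1) (φ p.2) : ℂ)
  real : ∀ r s : ℝ, (inner ℂ (φ r) (φ s) : ℂ).im = 0
  formula : ∀ r s : ℝ, r ∉ Set.range t → s ∉ Set.range t →
    (inner ℂ (φ r) (φ s) : ℂ) =
      ((weight t t' r * (-1) ^ ⌊phase t T φp φm r⌋ *
        (∑' k, t' k / ((r - t k) * (s - t k))) *
        ((-1) ^ ⌊phase t T φp φm s⌋ * weight t t' s) : ℝ) : ℂ)

/-! ## The local bandlimit space -/

/-- The kernel `K(r, s) = ⟨φ_r, φ_s⟩` on `ℝ × ℝ`, with scalars regarded as operators on `ℂ`. -/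
def gramKernel (φ : ℝ → H) : Matrix ℝ ℝ (ℂ →L[ℂ] ℂ) :=
  Matrix.of fun r s => (inner ℂ (φ r) (φ s) : ℂ) • ContinuousLinearMap.id ℂ ℂ

theorem gramKernel_posSemidef (φ : ℝ → H) : (gramKernel φ).PosSemidef := by
  have key := (RKHS.posSemidef_tfae (K := gramKernel φ)).out 0 2
  rw [key]
  refine ⟨?_, fun v => ?_⟩
  · ext r s
    have h1 : ContinuousLinearMap.adjoint (ContinuousLinearMap.id ℂ ℂ) =
        ContinuousLinearMap.id ℂ ℂ := star_one (ℂ →L[ℂ] ℂ)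
    simp [gramKernel, ContinuousLinearMap.star_eq_adjoint, h1]
  · have h : (v.sum fun x w => v.sum fun x' w' => (inner ℂ (gramKernel φ x' x w) w' : ℂ)) =
        inner ℂ (v.sum fun x w => w • φ x) (v.sum fun x w => w • φ x) := by
      simp only [Finsupp.sum, sum_inner, inner_sum]
      rw [Finset.sum_comm]
      refine Finset.sum_congr rfl fun x _ => Finset.sum_congr rfl fun y _ => ?_
      simp [gramKernel, inner_smul_left, inner_smul_right]
      exact Or.inl (mul_comm _ _)
    rw [h]
    exact inner_self_nonneg

instance gramKernel_fact (φ : ℝ → H) : Fact (gramKernel φ).PosSemidef :=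
  ⟨gramKernel_posSemidef φ⟩

/-- The reproducing kernel Hilbert space of functions `ℝ → ℂ` with kernel `⟨φ_r, φ_s⟩`. -/
abbrev LocalBandlimitSpace (φ : ℝ → H) : Type :=
  RKHS.OfKernel (gramKernel φ)

/-- The point evaluation vector `K_s`. -/
def pointEval (φ : ℝ → H) (s : ℝ) : LocalBandlimitSpace φ :=
  RKHS.kerFun (LocalBandlimitSpace φ) s (1 : ℂ)

/-- `U T U*`, with domain `U (dom T)`, for a linear isometry `U` of `H` onto `K`. -/
def unitaryConj {K : Type*} [NormedAddCommGroup K] [InnerProductSpace ℂ K]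
    (U : H ≃ₗᵢ[ℂ] K) (T : H →ₗ.[ℂ] H) : K →ₗ.[ℂ] K where
  domain := T.domain.comap (U.symm.toLinearEquiv : K →ₗ[ℂ] H)
  toFun := (U.toLinearEquiv : H →ₗ[ℂ] K) ∘ₗ T.toFun ∘ₗ
    (U.symm.toLinearEquiv : K →ₗ[ℂ] H).restrict (fun _ hx => hx)

end Operators

end BandlimitModel

end

open BandlimitModel

/-! Everything is read in the coordinates $x_n$ of the basis $\psi$. There $T_0$ is multiplication
by $t_n$, and since $\langle\phi_+,(T_0+i)x\rangle=\sum_n\sqrt{t_n'}\,x_n$, the transformation $T$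
is $T_0$ cut down by one linear condition; `IsNodeRestriction` records this. The properties making
up $\mathcal S^R$ follow from that description alone (`IsNodeRestriction.isSR`). A unitary map
transports the description, so the same lemma serves $T$ and its model $M^T$.

Because $b(T_0)\phi_+=\phi_-$ for the Cayley transform $b$, each $U_\theta$ is a rank one
perturbation of $b(T_0)$. Hence an eigenvector $v$ of $T_\theta$ at $s$ satisfies
$(s-t_n)v_n=c\sqrt{t_n'}$ with $c$ independent of $n$ (`mem_selfAdjointExt_iff_repr`). So $v$ is a
multiple of $g_s=\sum_n\sqrt{t_n'}(s-t_n)^{-1}\psi_n$, or of $\psi_m$ when $s=t_m$. The number $s$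
determines $\theta$, and eigenvector families become unit vectors with prescribed coordinates
(`isEigenvectorFamily_iff`), with $\theta$ and the phase gone.

The kernel formula is the Gram matrix of the normalized $g_s$. Multiplying $g_s$ by $s-t_m$ removes
its pole at $t_m$, and the factor $(-1)^{n(s)}$ compensates the sign of $s-t_m$ lost in normalizing;
this gives smoothness (`contDiff_eigenvector`).

For any family, the vectors at the nodes are multiples of the $\psi_n$, so the family is total. It
has the same Gram matrix as the point evaluations, which gives $U^T$
(`exists_linearIsometryEquiv_of_gram`). Finally $\phi_s\perp\operatorname{ran}(T-s)$
(`IsNodeRestriction.inner_eq_zero`), which says that $M^T$ multiplies by $s$. -/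

namespace HilbertBasis

/-! ### Coordinates in a Hilbert basis -/

open scoped InnerProductSpace ComplexConjugate

variable {ι H : Type*} [NormedAddCommGroup H] [InnerProductSpace ℂ H]

theorem ext_repr (ψ : HilbertBasis ι ℂ H) {x y : H} (h : ∀ n, ψ.repr x n = ψ.repr y n) :
    x = y :=
  ψ.repr.injective (lp.ext (funext h))

theorem repr_add (ψ : HilbertBasis ι ℂ H) (x y : H) (n : ι) :
    ψ.repr (x + y) n = ψ.repr x n + ψ.repr y n := by
  rw [map_add, lp.coeFn_add, Pi.add_apply]

theorem repr_sub (ψ : HilbertBasis ι ℂ H) (x y : H) (n : ι) :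
    ψ.repr (x - y) n = ψ.repr x n - ψ.repr y n := by
  rw [map_sub, lp.coeFn_sub, Pi.sub_apply]

theorem repr_smul (ψ : HilbertBasis ι ℂ H) (c : ℂ) (x : H) (n : ι) :
    ψ.repr (c • x) n = c * ψ.repr x n := by
  rw [map_smul, lp.coeFn_smul, Pi.smul_apply, smul_eq_mul]

theorem repr_zero (ψ : HilbertBasis ι ℂ H) (n : ι) : ψ.repr 0 n = 0 := by
  rw [map_zero, lp.coeFn_zero, Pi.zero_apply]

theorem continuous_repr (ψ : HilbertBasis ι ℂ H) (n : ι) : Continuous fun x => ψ.repr x n := by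
  simp only [ψ.repr_apply_apply]
  exact continuous_const.inner continuous_id

theorem hasSum_conj_repr_mul_repr (ψ : HilbertBasis ι ℂ H) (x y : H) :
    HasSum (fun n => conj (ψ.repr x n) * ψ.repr y n) ⟪x, y⟫_ℂ := by
  refine (ψ.hasSum_inner_mul_inner x y).congr_fun fun n => ?_
  rw [ψ.repr_apply_apply, ψ.repr_apply_apply, inner_conj_symm]

/-- By Parseval both sides are sums of the given terms, and convergence comes for free. Unbounded
factors such as $t_n$ can thus be moved between the two arguments termwise. -/
theorem inner_eq_of_repr (ψ : HilbertBasis ι ℂ H) {x y x' y' : H}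
    (h : ∀ n, conj (ψ.repr x n) * ψ.repr y n = conj (ψ.repr x' n) * ψ.repr y' n) :
    ⟪x, y⟫_ℂ = ⟪x', y'⟫_ℂ :=
  (ψ.hasSum_conj_repr_mul_repr x y).unique
    ((ψ.hasSum_conj_repr_mul_repr x' y').congr_fun h)

theorem hasSum_norm_sq_repr (ψ : HilbertBasis ι ℂ H) (x : H) :
    HasSum (fun n => ‖ψ.repr x n‖ ^ 2) (‖x‖ ^ 2) := by
  have h := Complex.reCLM.hasSum (ψ.hasSum_conj_repr_mul_repr x x)
  have e : (⟪x, x⟫_ℂ).re = ‖x‖ ^ 2 := by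
    rw [inner_self_eq_norm_sq_to_K]; norm_cast
  simp only [Complex.reCLM_apply, e] at h
  refine h.congr_fun fun n => ?_
  rw [mul_comm, Complex.mul_conj, Complex.ofReal_re, Complex.normSq_eq_norm_sq]

/-- The vector with a given square summable sequence of coordinates. -/
theorem repr_tsum_smul (ψ : HilbertBasis ι ℂ H) {b : ι → ℂ} (hb : Summable fun n => ‖b n‖ ^ 2)
    (n : ι) : ψ.repr (∑' k, b k • ψ k) n = b n := by
  have hm : Memℓp b 2 := memℓp_gen (by simpa using hb)
  have h := ψ.hasSum_repr_symm ⟨b, hm⟩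
  have e : ∑' k, b k • ψ k = ψ.repr.symm ⟨b, hm⟩ := h.tsum_eq
  rw [e, LinearIsometryEquiv.apply_symm_apply]

theorem repr_basis_self (ψ : HilbertBasis ι ℂ H) (m : ι) : ψ.repr (ψ m) m = 1 := by
  classical simp [ψ.repr_self]

theorem repr_basis_of_ne (ψ : HilbertBasis ι ℂ H) {m n : ι} (h : n ≠ m) :
    ψ.repr (ψ m) n = 0 := by
  classical simp [ψ.repr_self, h]

theorem eq_smul_basis (ψ : HilbertBasis ι ℂ H) {m : ι} {x : H}
    (h : ∀ n, n ≠ m → ψ.repr x n = 0) : x = ψ.repr x m • ψ m := by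
  refine ψ.ext_repr fun n => ?_
  rw [ψ.repr_smul]
  by_cases hn : n = m
  · subst hn; rw [repr_basis_self, mul_one]
  · rw [h n hn, ψ.repr_basis_of_ne hn, mul_zero]

/-- The bounded operator which is diagonal in a Hilbert basis. -/
theorem exists_diagonal (ψ : HilbertBasis ι ℂ H) (b : ι → ℂ) {C : ℝ} (hC : ∀ n, ‖b n‖ ≤ C) :
    ∃ D : H →L[ℂ] H, ∀ x n, ψ.repr (D x) n = b n * ψ.repr x n := by
  have hle : ∀ x n, ‖b n * ψ.repr x n‖ ^ 2 ≤ C ^ 2 * ‖ψ.repr x n‖ ^ 2 := fun x n => by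
    rw [norm_mul, mul_pow]; gcongr; exact hC n
  have hs : ∀ x, Summable fun n => ‖b n * ψ.repr x n‖ ^ 2 := fun x =>
    Summable.of_nonneg_of_le (fun _ => by positivity) (hle x)
      ((ψ.hasSum_norm_sq_repr x).summable.mul_left _)
  let f : H → H := fun x => ∑' k, (b k * ψ.repr x k) • ψ k
  have hf : ∀ x n, ψ.repr (f x) n = b n * ψ.repr x n := fun x n => ψ.repr_tsum_smul (hs x) n
  let L : H →ₗ[ℂ] H :=
    { toFun := f
      map_add' := fun x y => ψ.ext_repr fun n => by
        simp only [repr_add, hf, mul_add]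
      map_smul' := fun c x => ψ.ext_repr fun n => by
        simp only [repr_smul, hf, RingHom.id_apply, mul_left_comm] }
  refine ⟨L.mkContinuous |C| fun x => ?_, hf⟩
  refine abs_le_of_sq_le_sq' ?_ (by positivity) |>.2
  rw [mul_pow, sq_abs]
  refine hasSum_le (fun n => ?_) (ψ.hasSum_norm_sq_repr (L x))
    ((ψ.hasSum_norm_sq_repr x).mul_left (C ^ 2))
  rw [show ψ.repr (L x) n = _ from hf x n]
  exact hle x n

/-- The transport of a Hilbert basis by a unitary map. -/
noncomputable def mapIsometryEquiv {K : Type*} [NormedAddCommGroup K] [InnerProductSpace ℂ K]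
    (ψ : HilbertBasis ι ℂ H) (U : H ≃ₗᵢ[ℂ] K) : HilbertBasis ι ℂ K :=
  HilbertBasis.ofRepr (U.symm.trans ψ.repr)

theorem repr_mapIsometryEquiv_map {K : Type*} [NormedAddCommGroup K] [InnerProductSpace ℂ K]
    (ψ : HilbertBasis ι ℂ H) (U : H ≃ₗᵢ[ℂ] K) (x : H) :
    (ψ.mapIsometryEquiv U).repr (U x) = ψ.repr x :=
  congrArg ψ.repr (U.symm_apply_apply x)

theorem separableSpace [Countable ι] (ψ : HilbertBasis ι ℂ H) :
    TopologicalSpace.SeparableSpace H := by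
  have h1 : TopologicalSpace.IsSeparable (Set.range ψ) :=
    (Set.countable_range ψ).isSeparable
  have h2 := (h1.span (R := ℂ)).closure
  rw [← Submodule.topologicalClosure_coe, ψ.dense_span] at h2
  exact TopologicalSpace.isSeparable_univ_iff.1 h2

end HilbertBasis

/-! ### Total families with equal Gram matrices -/

section Gram

variable {X H K : Type*} [NormedAddCommGroup H] [InnerProductSpace ℂ H] [CompleteSpace H]
  [NormedAddCommGroup K] [InnerProductSpace ℂ K] [CompleteSpace K]

theorem denseRange_linearCombination {a : X → H} (ha : ∀ x, (∀ i, inner ℂ (a i) x = 0) → x = 0) :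
    DenseRange (Finsupp.linearCombination ℂ a) := by
  have h : (Submodule.span ℂ (Set.range a)).topologicalClosure = ⊤ := by
    rw [Submodule.topologicalClosure_eq_top_iff, Submodule.eq_bot_iff]
    intro x hx
    refine ha x fun i => ?_
    exact (Submodule.mem_orthogonal _ _).1 hx _ (Submodule.subset_span ⟨i, rfl⟩)
  rw [← Finsupp.range_linearCombination] at h
  have := Submodule.dense_iff_topologicalClosure_eq_top.2 h
  rwa [LinearMap.coe_range] at this

/-- Total families with the same Gram matrix are unitarily equivalent. -/
theorem exists_linearIsometryEquiv_of_gram {a : X → H} {b : X → K}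
    (ha : ∀ x, (∀ i, inner ℂ (a i) x = 0) → x = 0)
    (hb : ∀ x, (∀ i, inner ℂ (b i) x = 0) → x = 0)
    (h : ∀ i j, (inner ℂ (a i) (a j) : ℂ) = inner ℂ (b i) (b j)) :
    ∃ U : H ≃ₗᵢ[ℂ] K, ∀ i, U (a i) = b i := by
  -- The Gram matrix determines the norm of every finite combination, so sending one combination to
  -- the other is a well-defined isometry between dense subspaces.
  have hn : ∀ c : X →₀ ℂ,
      ‖Finsupp.linearCombination ℂ b c‖ = ‖Finsupp.linearCombination ℂ a c‖ := by
    intro c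
    have e : (inner ℂ (Finsupp.linearCombination ℂ b c) (Finsupp.linearCombination ℂ b c) : ℂ) =
        inner ℂ (Finsupp.linearCombination ℂ a c) (Finsupp.linearCombination ℂ a c) := by
      simp only [Finsupp.linearCombination_apply, Finsupp.sum, sum_inner, inner_sum,
        inner_smul_left, inner_smul_right, h]
    rw [@norm_eq_sqrt_re_inner ℂ, @norm_eq_sqrt_re_inner ℂ, e]
  refine ⟨LinearEquiv.extendOfIsometry (LinearEquiv.refl ℂ (X →₀ ℂ))
    (Finsupp.linearCombination ℂ a) (Finsupp.linearCombination ℂ b)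
    (denseRange_linearCombination ha) (denseRange_linearCombination hb) hn, fun i => ?_⟩
  have := LinearEquiv.extendOfIsometry_eq (LinearEquiv.refl ℂ (X →₀ ℂ))
    (Finsupp.linearCombination ℂ a) (Finsupp.linearCombination ℂ b)
    (denseRange_linearCombination ha) (denseRange_linearCombination hb) hn (Finsupp.single i 1)
  simpa using this

end Gram

/-! ### Spacing of the nodes and the node index -/

namespace BandlimitModel

namespace IsBandlimitPair

variable {F : Set ℤ} {t t' : F → ℝ}

theorem nonempty (h : IsBandlimitPair F t t') : Nonempty F := by
  rcases h.index with rfl | rfl | rfl | ⟨N, rfl⟩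
  · exact ⟨⟨0, by simp⟩⟩
  · exact ⟨⟨0, by simp⟩⟩
  · exact ⟨⟨0, by simp⟩⟩
  · exact ⟨⟨0, by simp⟩⟩

theorem exists_gap (h : IsBandlimitPair F t t') (s : ℝ) :
    ∃ δ > 0, ∀ n, t n ≠ s → δ ≤ |s - t n| := by
  have h1 := h.no_accPt s
  rw [accPt_iff_nhds] at h1
  push Not at h1
  obtain ⟨U, hU, h2⟩ := h1
  obtain ⟨δ, hδ, hb⟩ := Metric.mem_nhds_iff.1 hU
  refine ⟨δ, hδ, fun n hn => ?_⟩
  by_contra! hlt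
  refine hn (h2 (t n) ⟨hb ?_, n, rfl⟩)
  rwa [Metric.mem_ball, dist_comm, Real.dist_eq]

theorem finite_mem_Icc (h : IsBandlimitPair F t t') (a b : ℝ) :
    {n | t n ∈ Set.Icc a b}.Finite := by
  by_contra hinf
  have h1 : (t '' {n | t n ∈ Set.Icc a b}).Infinite :=
    Set.Infinite.image h.strictMono.injective.injOn hinf
  obtain ⟨x, -, hx⟩ := h1.exists_accPt_of_subset_isCompact (isCompact_Icc (a := a) (b := b))
    (by rintro _ ⟨n, hn, rfl⟩; exact hn)
  exact h.no_accPt x (hx.mono (Filter.principal_mono.2 (Set.image_subset_range _ _)))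

/-- This is what makes the default value $-1$ of `nodeIndex` equal to $m-1$ to the left of the first
node. -/
theorem eq_zero_of_isLeast (h : IsBandlimitPair F t t') {m : F} (hm : ∀ n, m ≤ n) :
    (m : ℤ) = 0 := by
  obtain ⟨m, hmF⟩ := m
  rcases h.index with rfl | rfl | rfl | ⟨N, rfl⟩
  · have := hm ⟨0, by simp⟩
    simp only [Subtype.mk_le_mk, Set.mem_Ici] at this hmF ⊢; omega
  · have h1 : m - 1 ∈ Set.Iic (0 : ℤ) := by simp only [Set.mem_Iic] at hmF ⊢; omega
    have := hm ⟨m - 1, h1⟩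
    simp only [Subtype.mk_le_mk] at this; omega
  · have := hm ⟨m - 1, by simp⟩
    simp only [Subtype.mk_le_mk] at this; omega
  · have := hm ⟨0, by simp⟩
    simp only [Subtype.mk_le_mk, Set.mem_Icc] at this hmF ⊢; omega

theorem sub_one_mem (h : IsBandlimitPair F t t') {m n : F} (hn : n < m) : (m : ℤ) - 1 ∈ F := by
  obtain ⟨m, hmF⟩ := m
  obtain ⟨n, hnF⟩ := n
  rw [Subtype.mk_lt_mk] at hn
  rcases h.index with rfl | rfl | rfl | ⟨N, rfl⟩ <;>
    simp only [Set.mem_Ici, Set.mem_Iic, Set.mem_Icc, Set.mem_univ] at hmF hnF ⊢ <;> omega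

theorem nodeIndex_eq (_h : IsBandlimitPair F t t') {s : ℝ} {m : F} (hm : t m ≤ s)
    (hgt : ∀ n, m < n → s < t n) : nodeIndex t s = m := by
  rw [nodeIndex, if_pos ⟨m, hm⟩]
  refine IsGreatest.csSup_eq ⟨⟨m.2, hm⟩, ?_⟩
  rintro n ⟨hn, hns⟩
  by_contra! hlt
  exact absurd hns (not_le.2 (hgt ⟨n, hn⟩ hlt))

theorem nodeIndex_eq_sub_one (h : IsBandlimitPair F t t') {s : ℝ} {m : F} (hm : s < t m)
    (hlt : ∀ n, n < m → t n ≤ s) : nodeIndex t s = m - 1 := by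
  by_cases hmin : ∃ n, n < m
  · obtain ⟨n, hn⟩ := hmin
    have hF := h.sub_one_mem hn
    have := h.nodeIndex_eq (m := ⟨(m : ℤ) - 1, hF⟩) (s := s)
      (hlt _ (show (m : ℤ) - 1 < m by omega)) fun k hk => by
        have : m ≤ k := by
          have hk' : (m : ℤ) - 1 < k := hk
          exact show (m : ℤ) ≤ k by omega
        exact hm.trans_le (h.strictMono.monotone this)
    exact this
  · push Not at hmin
    rw [nodeIndex, if_neg, h.eq_zero_of_isLeast hmin, zero_sub]
    rintro ⟨n, hn⟩
    exact absurd (hm.trans_le (h.strictMono.monotone (hmin n))) (not_lt.2 hn)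

/-- Near a point `s₀` there is at most one node `tₘ`, and the node index is `m` to the right
of `tₘ` and `m - 1` to the left of `tₘ`. -/
theorem exists_local_node (h : IsBandlimitPair F t t') (s₀ : ℝ) :
    ∃ m : F, (∀ n, n ≠ m → t n ≠ s₀) ∧ ∀ᶠ s in nhds s₀, (∀ n, n ≠ m → t n ≠ s) ∧
      (t m ≤ s → nodeIndex t s = m) ∧ (s < t m → nodeIndex t s = m - 1) := by
  -- Take the last node not exceeding $s_0$, or the first node if there is none; local finiteness of
  -- the nodes provides it.
  have key : ∃ m : F, (∀ n, m < n → s₀ < t n) ∧ ∀ n, n < m → t n < s₀ := by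
    by_cases hne : ∃ n, t n ≤ s₀
    · obtain ⟨n₀, hn₀⟩ := hne
      obtain ⟨m, hm⟩ := (h.finite_mem_Icc (t n₀) s₀).exists_maximal ⟨n₀, le_rfl, hn₀⟩
      refine ⟨m, fun n hn => ?_, fun n hn => (h.strictMono hn).trans_le hm.1.2⟩
      by_contra! hle
      exact absurd (hm.2 ⟨hm.1.1.trans (h.strictMono hn).le, hle⟩ hn.le) (not_le.2 hn)
    · push Not at hne
      obtain ⟨n₀⟩ := h.nonempty
      obtain ⟨m, hm⟩ := (h.finite_mem_Icc s₀ (t n₀)).exists_minimal ⟨n₀, (hne n₀).le, le_rfl⟩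
      refine ⟨m, fun n _ => hne n, fun n hn => ?_⟩
      exact absurd (hm.2 ⟨(hne n).le, (h.strictMono hn).le.trans hm.1.2⟩ hn.le) (not_le.2 hn)
  obtain ⟨m, hgt, hlt⟩ := key
  obtain ⟨δ, hδ, hgap⟩ := h.exists_gap s₀
  refine ⟨m, fun n hn => ?_, ?_⟩
  · rcases lt_or_gt_of_ne hn with hn | hn
    · exact (hlt n hn).ne
    · exact (hgt n hn).ne'
  · filter_upwards [Metric.ball_mem_nhds s₀ hδ] with s hs
    rw [Metric.mem_ball, Real.dist_eq, abs_lt] at hs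
    have hgt' : ∀ n, m < n → s < t n := fun n hn => by
      have h1 := hgt n hn
      have h2 := hgap n h1.ne'
      rw [abs_of_neg (by linarith)] at h2
      linarith
    have hlt' : ∀ n, n < m → t n < s := fun n hn => by
      have h1 := hlt n hn
      have h2 := hgap n h1.ne
      rw [abs_of_pos (by linarith)] at h2
      linarith
    refine ⟨fun n hn => ?_, fun hm => h.nodeIndex_eq hm hgt',
      fun hm => h.nodeIndex_eq_sub_one hm fun n hn => (hlt' n hn).le⟩
    rcases lt_or_gt_of_ne hn with hn | hn
    · exact (hlt' n hn).ne
    · exact (hgt' n hn).ne'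

theorem nodeIndex_node (h : IsBandlimitPair F t t') (m : F) : nodeIndex t (t m) = m :=
  h.nodeIndex_eq le_rfl fun _ hn => h.strictMono hn

theorem summable_div_sub_sq (h : IsBandlimitPair F t t') (s : ℝ) :
    Summable fun n => t' n / (s - t n) ^ 2 := by
  obtain ⟨δ, hδ, hgap⟩ := h.exists_gap s
  -- The constant comes from $1+t_n^2\le 1+2s^2+2(s-t_n)^2$ and $\delta\le|s-t_n|$. A node equal to
  -- $s$ contributes $0$, because division by zero yields zero.
  refine Summable.of_nonneg_of_le (fun n => div_nonneg (h.pos n).le (sq_nonneg _)) (fun n => ?_)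
    (h.summable.mul_left ((1 + 2 * s ^ 2) / δ ^ 2 + 2))
  have hp := h.pos n
  by_cases hn : t n = s
  · rw [hn, sub_self]
    simp only [ne_eq, OfNat.ofNat_ne_zero, not_false_eq_true, zero_pow, div_zero]
    positivity
  · have h1 : δ ^ 2 ≤ (s - t n) ^ 2 := by
      rw [← sq_abs (s - t n)]
      exact pow_le_pow_left₀ hδ.le (hgap n hn) 2
    have h2 : 0 < (s - t n) ^ 2 := lt_of_lt_of_le (by positivity) h1
    rw [mul_div_assoc', div_le_div_iff₀ h2 (by positivity)]
    have h3 : 1 + 2 * s ^ 2 ≤ (1 + 2 * s ^ 2) / δ ^ 2 * (s - t n) ^ 2 := by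
      rw [div_mul_eq_mul_div, le_div_iff₀ (by positivity)]
      gcongr
    have h4 : 1 + t n ^ 2 ≤ ((1 + 2 * s ^ 2) / δ ^ 2 + 2) * (s - t n) ^ 2 := by
      nlinarith [sq_nonneg (2 * s - t n)]
    nlinarith

end IsBandlimitPair

end BandlimitModel

/-! ### Surjectivity of a self-adjoint operator that is bounded below -/

section SelfAdjoint

variable {E : Type*} [NormedAddCommGroup E] [InnerProductSpace ℂ E] [CompleteSpace E]

omit [CompleteSpace E] in
theorem Submodule.mem_span_singleton_of_forall_inner_eq_zero {p x : E}
    (h : ∀ w, (inner ℂ p w : ℂ) = 0 → (inner ℂ w x : ℂ) = 0) : x ∈ ℂ ∙ p := by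
  rw [← Submodule.orthogonal_orthogonal (ℂ ∙ p)]
  refine (Submodule.mem_orthogonal _ _).2 fun w hw => h w ?_
  exact Submodule.mem_orthogonal_singleton_iff_inner_right.1 hw

/-- If `A` is self-adjoint and `A - r` is bounded below for a real `r` then `A - r` is onto. -/
theorem LinearPMap.exists_sub_smul_eq {A : E →ₗ.[ℂ] E} (hA : IsSelfAdjoint A) {r c : ℝ}
    (hc : 0 < c) (hb : ∀ x : A.domain, c * ‖(x : E)‖ ≤ ‖A x - (r : ℂ) • (x : E)‖) (v : E) :
    ∃ x : A.domain, A x - (r : ℂ) • (x : E) = v := by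
  have hcl : _root_.IsClosed (A.graph : Set (E × E)) := hA.isClosed
  have : CompleteSpace A.graph := hcl.completeSpace_coe
  let f : A.graph →L[ℂ] E := ((ContinuousLinearMap.snd ℂ E E) -
    (r : ℂ) • (ContinuousLinearMap.fst ℂ E E)).comp A.graph.subtypeL
  have hf : ∀ p : A.graph, f p = p.1.2 - (r : ℂ) • p.1.1 := fun p => rfl
  have hb' : ∀ p : A.graph, c * ‖p.1.1‖ ≤ ‖f p‖ := by
    rintro ⟨⟨x, y⟩, hp⟩
    obtain ⟨z, hz, rfl⟩ := A.mem_graph_iff.1 hp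
    simp only at hz
    subst hz
    exact hb z
  -- The bound on $x$ also controls $Ax=(A-r)x+rx$, so $A-r$ is bounded below in the graph norm; the
  -- graph being complete, its range is closed.
  have hanti : AntilipschitzWith (Real.toNNReal (1 + (|r| + 1) / c)) f := by
    refine ContinuousLinearMap.antilipschitz_of_bound f fun p => ?_
    rw [Real.coe_toNNReal _ (by positivity)]
    have h1 : ‖p.1.1‖ ≤ ‖f p‖ / c := by rw [le_div_iff₀ hc, mul_comm]; exact hb' p
    have h2 : ‖p.1.2‖ ≤ ‖f p‖ + |r| * ‖p.1.1‖ := by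
      have e : p.1.2 = f p + (r : ℂ) • p.1.1 := by rw [hf]; abel
      calc ‖p.1.2‖ = ‖f p + (r : ℂ) • p.1.1‖ := congrArg _ e
        _ ≤ ‖f p‖ + ‖(r : ℂ) • p.1.1‖ := norm_add_le _ _
        _ = _ := by rw [norm_smul, Complex.norm_real, Real.norm_eq_abs]
    have h3 : |r| * ‖p.1.1‖ ≤ |r| * (‖f p‖ / c) := by gcongr
    have h4 : 0 ≤ ‖f p‖ / c := by positivity
    have h5 : 0 ≤ |r| * (‖f p‖ / c) := by positivity
    have e : (1 + (|r| + 1) / c) * ‖f p‖ = ‖f p‖ + |r| * (‖f p‖ / c) + ‖f p‖ / c := by ring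
    rw [e]
    have h6 : ‖p‖ = max ‖p.1.1‖ ‖p.1.2‖ := rfl
    rw [h6]
    exact max_le (by linarith [norm_nonneg (f p)]) (by linarith)
  have hrc : _root_.IsClosed (LinearMap.range f.toLinearMap : Set E) :=
    hanti.isClosed_range f.uniformContinuous
  have htop : LinearMap.range f.toLinearMap = ⊤ := by
    rw [← hrc.submodule_topologicalClosure_eq, Submodule.topologicalClosure_eq_top_iff,
      Submodule.eq_bot_iff]
    intro w hw
    -- A vector orthogonal to $\operatorname{ran}(A-r)$ lies in $\ker(A^*-r)=\ker(A-r)$, and the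
    -- lower bound makes that kernel trivial.
    have hw' : (w, (r : ℂ) • w) ∈ A.graph := by
      have e : A.graph = A.graph.adjoint := by
        rw [← LinearPMap.adjoint_graph_eq_graph_adjoint hA.dense_domain,
          LinearPMap.isSelfAdjoint_def.1 hA]
      rw [e, Submodule.mem_adjoint_iff]
      intro a b hab
      have := (Submodule.mem_orthogonal _ _).1 hw _ ⟨⟨(a, b), hab⟩, rfl⟩
      rw [ContinuousLinearMap.coe_coe, hf, inner_sub_left, inner_smul_left] at this
      rw [inner_smul_right]
      simpa using this
    have := hb' ⟨_, hw'⟩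
    rw [hf, sub_self, norm_zero] at this
    exact norm_le_zero_iff.1 (le_of_mul_le_mul_left (by simpa using this) hc)
  obtain ⟨⟨⟨x, y⟩, hp⟩, hx⟩ := LinearMap.mem_range.1 (htop ▸ Submodule.mem_top : v ∈ _)
  obtain ⟨z, hz, hy⟩ := A.mem_graph_iff.1 hp
  refine ⟨z, ?_⟩
  rw [ContinuousLinearMap.coe_coe, hf] at hx
  simp only at hz hy hx
  rw [hy, hz, hx]

end SelfAdjoint

/-! ### The restriction $T$ in coordinates and its membership in $\mathcal S^R$ -/

namespace BandlimitModel

open scoped InnerProductSpace ComplexConjugate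

section Coordinates

variable {ι H : Type*} [NormedAddCommGroup H] [InnerProductSpace ℂ H]

theorem ofReal_add_I_ne_zero (x : ℝ) : (x : ℂ) + Complex.I ≠ 0 := fun h => by
  simpa using congrArg Complex.im h

theorem ofReal_sub_I_ne_zero (x : ℝ) : (x : ℂ) - Complex.I ≠ 0 := fun h => by
  simpa using congrArg Complex.im h

theorem norm_sq_ofReal_add_I (x : ℝ) : ‖(x : ℂ) + Complex.I‖ ^ 2 = 1 + x ^ 2 := by
  rw [← Complex.normSq_eq_norm_sq, Complex.normSq_apply]
  simp
  ring

theorem norm_sq_ofReal_sub_I (x : ℝ) : ‖(x : ℂ) - Complex.I‖ ^ 2 = 1 + x ^ 2 := by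
  rw [← Complex.normSq_eq_norm_sq, Complex.normSq_apply]
  simp
  ring

/-- Used with $\sigma=\pm i$: both $(t_n+\sigma)^{-1}$ and $t_n(t_n+\sigma)^{-1}$ are bounded by
$1$, so $T_0+\sigma$ is inverted by bounded diagonal operators. -/
theorem exists_sub_mul_eq (ψ : HilbertBasis ι ℂ H) (t : ι → ℝ) {σ : ℂ}
    (hσ : ∀ x : ℝ, ‖(x : ℂ) + σ‖ ^ 2 = 1 + x ^ 2) (w : H) :
    ∃ x y : H, (∀ n, ψ.repr y n = t n * ψ.repr x n) ∧ y + σ • x = w := by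
  have h0 : ∀ x : ℝ, (x : ℂ) + σ ≠ 0 := fun x h => by
    have := hσ x
    rw [h, norm_zero] at this
    nlinarith [sq_nonneg x]
  have h1 : ∀ x : ℝ, 1 ≤ ‖(x : ℂ) + σ‖ := fun x => by
    refine abs_le_of_sq_le_sq' ?_ (norm_nonneg _) |>.2
    rw [hσ]; nlinarith [sq_nonneg x]
  have h2 : ∀ x : ℝ, |x| ≤ ‖(x : ℂ) + σ‖ := fun x => by
    refine abs_le_of_sq_le_sq' ?_ (norm_nonneg _) |>.2
    rw [hσ, sq_abs]; linarith
  obtain ⟨D, hD⟩ := ψ.exists_diagonal (fun n => ((t n : ℂ) + σ)⁻¹) (C := 1) fun n => by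
    rw [norm_inv]; exact inv_le_one_of_one_le₀ (h1 _)
  obtain ⟨D', hD'⟩ := ψ.exists_diagonal (fun n => (t n : ℂ) / ((t n : ℂ) + σ)) (C := 1) fun n => by
    rw [norm_div, Complex.norm_real, Real.norm_eq_abs]
    exact div_le_one_of_le₀ (h2 _) (norm_nonneg _)
  refine ⟨D w, D' w, fun n => ?_, ψ.ext_repr fun n => ?_⟩
  · rw [hD, hD', div_eq_mul_inv, mul_assoc]
  · have := h0 (t n)
    rw [ψ.repr_add, ψ.repr_smul, hD, hD']
    field_simp

/-- The graph of `T` consists of the pairs `(x, y)` for which the coordinates satisfy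
`yₙ = tₙ xₙ` and `y + i x` is orthogonal to `φ₊`. -/
def IsNodeRestriction (t : ι → ℝ) (ψ : HilbertBasis ι ℂ H) (φp : H) (T : H →ₗ.[ℂ] H) : Prop :=
  ∀ x y : H, (x, y) ∈ T.graph ↔
    (∀ n, ψ.repr y n = t n * ψ.repr x n) ∧ (inner ℂ φp (y + Complex.I • x) : ℂ) = 0

end Coordinates

variable {H : Type*} [NormedAddCommGroup H] [InnerProductSpace ℂ H]
variable {F : Set ℤ} {t t' : F → ℝ} {ψ : HilbertBasis F ℂ H} {φp φm : H} {T : H →ₗ.[ℂ] H}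

theorem IsBandlimitPair.summable_norm_sq_phiPlus (h : IsBandlimitPair F t t') :
    Summable fun n => ‖(Real.sqrt (t' n) : ℂ) / ((t n : ℂ) - Complex.I)‖ ^ 2 := by
  refine h.summable.congr fun n => ?_
  rw [norm_div, div_pow, norm_sq_ofReal_sub_I, Complex.norm_real, Real.norm_eq_abs, sq_abs,
    Real.sq_sqrt (h.pos n).le]

theorem IsBandlimitPair.summable_norm_sq_phiMinus (h : IsBandlimitPair F t t') :
    Summable fun n => ‖(Real.sqrt (t' n) : ℂ) / ((t n : ℂ) + Complex.I)‖ ^ 2 := by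
  refine h.summable.congr fun n => ?_
  rw [norm_div, div_pow, norm_sq_ofReal_add_I, Complex.norm_real, Real.norm_eq_abs, sq_abs,
    Real.sq_sqrt (h.pos n).le]

theorem IsBandlimitPair.repr_phiPlus (h : IsBandlimitPair F t t') (ψ : HilbertBasis F ℂ H)
    (n : F) : ψ.repr (phiPlus t t' ψ) n = Real.sqrt (t' n) / ((t n : ℂ) - Complex.I) :=
  ψ.repr_tsum_smul h.summable_norm_sq_phiPlus n

theorem IsBandlimitPair.repr_phiMinus (h : IsBandlimitPair F t t') (ψ : HilbertBasis F ℂ H)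
    (n : F) : ψ.repr (phiMinus t t' ψ) n = Real.sqrt (t' n) / ((t n : ℂ) + Complex.I) :=
  ψ.repr_tsum_smul h.summable_norm_sq_phiMinus n

theorem IsBandlimitPair.sqrt_ne_zero (h : IsBandlimitPair F t t') (n : F) :
    (Real.sqrt (t' n) : ℂ) ≠ 0 := by
  rw [Complex.ofReal_ne_zero]
  exact (Real.sqrt_pos.2 (h.pos n)).ne'

theorem conj_div_sub_I (a x : ℝ) :
    conj ((a : ℂ) / ((x : ℂ) - Complex.I)) = a / ((x : ℂ) + Complex.I) := by
  simp

theorem conj_div_add_I (a x : ℝ) :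
    conj ((a : ℂ) / ((x : ℂ) + Complex.I)) = a / ((x : ℂ) - Complex.I) := by
  rw [map_div₀, map_add, Complex.conj_ofReal, Complex.conj_ofReal, Complex.conj_I,
    sub_eq_add_neg]

theorem IsBandlimitPair.ne_zero_of_repr (h : IsBandlimitPair F t t')
    (hp : ∀ n, ψ.repr φp n = Real.sqrt (t' n) / ((t n : ℂ) - Complex.I)) : φp ≠ 0 := by
  rintro rfl
  obtain ⟨n⟩ := h.nonempty
  have := hp n
  rw [ψ.repr_zero] at this
  exact div_ne_zero (h.sqrt_ne_zero n) (ofReal_sub_I_ne_zero _) this.symm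

namespace IsNodeRestriction

variable (hT : IsNodeRestriction t ψ φp T)
  (hp : ∀ n, ψ.repr φp n = Real.sqrt (t' n) / ((t n : ℂ) - Complex.I))
  (hm : ∀ n, ψ.repr φm n = Real.sqrt (t' n) / ((t n : ℂ) + Complex.I))
include hT

theorem repr_apply (x : T.domain) (n : F) : ψ.repr (T x) n = t n * ψ.repr x n :=
  ((hT _ _).1 (T.mem_graph x)).1 n

theorem exists_add_eq {w : H} (hw : (inner ℂ φp w : ℂ) = 0) :
    ∃ x y, (x, y) ∈ T.graph ∧ y + Complex.I • x = w := by
  obtain ⟨x, y, h1, h2⟩ := exists_sub_mul_eq ψ t norm_sq_ofReal_add_I w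
  exact ⟨x, y, (hT x y).2 ⟨h1, h2 ▸ hw⟩, h2⟩

include hp hm in
-- The conditions $y+ix\perp\phi_+$ and $y-ix\perp\phi_-$ coincide: both have the terms
-- $\sqrt{t_n'}\,x_n$.
theorem exists_sub_eq {w : H} (hw : (inner ℂ φm w : ℂ) = 0) :
    ∃ x y, (x, y) ∈ T.graph ∧ y - Complex.I • x = w := by
  obtain ⟨x, y, h1, h2⟩ := exists_sub_mul_eq ψ t (σ := -Complex.I)
    (fun x => by rw [← sub_eq_add_neg, norm_sq_ofReal_sub_I]) w
  refine ⟨x, y, (hT x y).2 ⟨h1, ?_⟩, by rw [← h2, neg_smul, sub_eq_add_neg]⟩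
  rw [← hw, ← h2]
  refine ψ.inner_eq_of_repr fun n => ?_
  have e1 := ofReal_add_I_ne_zero (t n)
  have e2 := ofReal_sub_I_ne_zero (t n)
  rw [hp, hm, conj_div_sub_I, conj_div_add_I, ψ.repr_add, ψ.repr_add, ψ.repr_smul, ψ.repr_smul, h1]
  field_simp
  ring

theorem isClosed : T.IsClosed := by
  have e : (T.graph : Set (H × H)) =
      (⋂ n, {p | ψ.repr p.2 n = t n * ψ.repr p.1 n}) ∩
        {p | (inner ℂ φp (p.2 + Complex.I • p.1) : ℂ) = 0} := by
    ext ⟨x, y⟩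
    simp only [SetLike.mem_coe, hT x y, Set.mem_inter_iff, Set.mem_iInter, Set.mem_ofPred_eq]
  rw [LinearPMap.IsClosed, e]
  refine IsClosed.inter (isClosed_iInter fun n => isClosed_eq ?_ ?_) (isClosed_eq ?_ ?_)
  · exact (ψ.continuous_repr n).comp continuous_snd
  · exact continuous_const.mul ((ψ.continuous_repr n).comp continuous_fst)
  · exact continuous_const.inner (continuous_snd.add (continuous_fst.const_smul _))
  · exact continuous_const

theorem isFormalAdjoint : T.IsFormalAdjoint T := fun x y =>
  ψ.inner_eq_of_repr fun n => by
    rw [hT.repr_apply, hT.repr_apply, map_mul, Complex.conj_ofReal]; ring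

include hp in
-- Termwise $\overline{v_n}(t_n-s)x_n=-\bar c\sqrt{t_n'}\,x_n$, so the pairing is a multiple of the
-- functional that defines $\mathrm{dom}\,T$.
theorem inner_eq_zero {v : H} {s : ℝ} {c : ℂ}
    (hv : ∀ n, ((s : ℂ) - t n) * ψ.repr v n = c * Real.sqrt (t' n)) {x y : H}
    (hxy : (x, y) ∈ T.graph) : (inner ℂ v (y - (s : ℂ) • x) : ℂ) = 0 := by
  have h := (hT x y).1 hxy
  have e : (inner ℂ v (y - (s : ℂ) • x) : ℂ) = inner ℂ (-c • φp) (y + Complex.I • x) := by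
    refine ψ.inner_eq_of_repr fun n => ?_
    have e1 := ofReal_add_I_ne_zero (t n)
    have hc := congrArg conj (hv n)
    simp only [map_mul, map_sub, Complex.conj_ofReal] at hc
    rw [ψ.repr_smul, hp, map_mul, conj_div_sub_I, ψ.repr_sub, ψ.repr_add, ψ.repr_smul,
      ψ.repr_smul, h.1, map_neg]
    field_simp
    linear_combination (-ψ.repr x n) * hc
  rw [e, inner_smul_left, h.2, mul_zero]

include hp in
-- Off the nodes the gap bounds the inverse of $T_0-r$. At $r=t_m$ only the coordinate $x_m$ is
-- lost, and the condition $\sum_n\sqrt{t_n'}\,x_n=0$ recovers it from the others.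
theorem isRegular (hpair : IsBandlimitPair F t t') : IsRegular T := by
  intro r
  obtain ⟨δ, hδ, hgap⟩ := hpair.exists_gap r
  obtain ⟨D, hD⟩ := ψ.exists_diagonal (fun n => ((t n : ℂ) - r)⁻¹) (C := δ⁻¹) fun n => by
    rw [norm_inv]
    by_cases hn : t n = r
    · rw [hn, sub_self, norm_zero, inv_zero]; positivity
    · refine inv_anti₀ hδ ?_
      rw [← Complex.ofReal_sub, Complex.norm_real, Real.norm_eq_abs, abs_sub_comm]
      exact hgap n hn
  suffices h : ∃ C : ℝ, 0 < C ∧ ∀ x : T.domain, ‖(x : H)‖ ≤ C * ‖T x - (r : ℂ) • (x : H)‖ by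
    obtain ⟨C, hC, h⟩ := h
    refine ⟨C⁻¹, inv_pos.2 hC, fun x => ?_⟩
    rw [inv_mul_le_iff₀ hC]
    exact h x
  have hcoord : ∀ (x : T.domain) n, t n ≠ r →
      ψ.repr (D (T x - (r : ℂ) • (x : H))) n = ψ.repr x n := fun x n hn => by
    have : (t n : ℂ) - r ≠ 0 := by
      rw [← Complex.ofReal_sub, Complex.ofReal_ne_zero]; exact sub_ne_zero.2 hn
    rw [hD, ψ.repr_sub, ψ.repr_smul, hT.repr_apply]
    field_simp
  by_cases hr : ∃ m, t m = r
  · obtain ⟨m, rfl⟩ := hr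
    have hne : ∀ n, n ≠ m → t n ≠ t m := fun n hn h => hn (hpair.strictMono.injective h)
    have hsq := hpair.summable_div_sub_sq (t m)
    set G : H := ∑' n, ((Real.sqrt (t' n) : ℂ) / ((t n : ℂ) - t m)) • ψ n with hG
    have hGn : ∀ n, ψ.repr G n = (Real.sqrt (t' n) : ℂ) / ((t n : ℂ) - t m) := fun n => by
      refine ψ.repr_tsum_smul (hsq.congr fun n => ?_) n
      rw [← Complex.ofReal_sub, ← Complex.ofReal_div, Complex.norm_real, Real.norm_eq_abs, sq_abs,
        div_pow, Real.sq_sqrt (hpair.pos n).le]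
      ring
    have hsm := Real.sqrt_pos.2 (hpair.pos m)
    have hDn : ∀ v, ‖D v‖ ≤ ‖D‖ * ‖v‖ := D.le_opNorm
    refine ⟨‖D‖ + ‖G‖ / Real.sqrt (t' m) + 1, by positivity, fun x => ?_⟩
    set v := T x - ((t m : ℝ) : ℂ) • (x : H) with hv
    -- For $n\ne m$ one has $x_n=v_n/(t_n-t_m)$, so the remaining part of the sum is $\langle
    -- G,v\rangle$; the $m$th coordinate of $G$ is $0$ by the division convention.
    have h0 : (Real.sqrt (t' m) : ℂ) * ψ.repr x m = -inner ℂ G v := by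
      have h1 := ((hT _ _).1 (T.mem_graph x)).2
      have h2 : (inner ℂ φp (T x + Complex.I • (x : H)) : ℂ) =
          inner ℂ ((Real.sqrt (t' m) : ℂ) • ψ m) (x : H) + inner ℂ G v := by
        refine (ψ.hasSum_conj_repr_mul_repr _ _).unique
          (((ψ.hasSum_conj_repr_mul_repr _ _).add (ψ.hasSum_conj_repr_mul_repr _ _)).congr_fun
            fun n => ?_)
        have e1 := ofReal_add_I_ne_zero (t n)
        rw [hp, conj_div_sub_I, ψ.repr_add, ψ.repr_smul, hT.repr_apply, hGn, hv, ψ.repr_sub,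
          ψ.repr_smul, ψ.repr_smul, hT.repr_apply, map_mul, map_div₀, map_sub]
        simp only [Complex.conj_ofReal]
        by_cases hn : n = m
        · subst hn
          rw [ψ.repr_basis_self, map_one, sub_self, div_zero]
          field_simp
          ring
        · have e2 : (t n : ℂ) - t m ≠ 0 := by
            rw [← Complex.ofReal_sub, Complex.ofReal_ne_zero]; exact sub_ne_zero.2 (hne n hn)
          rw [ψ.repr_basis_of_ne hn, map_zero]
          field_simp
          ring
      rw [h1, inner_smul_left, Complex.conj_ofReal, ← ψ.repr_apply_apply] at h2
      linear_combination -h2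
    have h1 : ‖ψ.repr x m‖ ≤ ‖G‖ / Real.sqrt (t' m) * ‖v‖ := by
      rw [div_mul_eq_mul_div, le_div_iff₀ hsm]
      have := congrArg norm h0
      rw [norm_mul, Complex.norm_real, Real.norm_eq_abs, abs_of_pos hsm, norm_neg] at this
      rw [mul_comm, this]
      exact norm_inner_le_norm _ _
    have hx : (x : H) = D v + ψ.repr x m • ψ m := by
      refine ψ.ext_repr fun n => ?_
      rw [ψ.repr_add, ψ.repr_smul]
      by_cases hn : n = m
      · subst hn
        rw [ψ.repr_basis_self, hD, sub_self, inv_zero]; ring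
      · rw [ψ.repr_basis_of_ne hn, hcoord x n (hne n hn)]; ring
    calc ‖(x : H)‖ = ‖D v + ψ.repr x m • ψ m‖ := congrArg _ hx
      _ ≤ ‖D v‖ + ‖ψ.repr x m • ψ m‖ := norm_add_le _ _
      _ ≤ ‖D‖ * ‖v‖ + ‖G‖ / Real.sqrt (t' m) * ‖v‖ := by
        rw [norm_smul, ψ.orthonormal.1 m, mul_one]
        exact add_le_add (hDn v) h1
      _ ≤ _ := by nlinarith [norm_nonneg v]
  · push Not at hr
    refine ⟨‖D‖ + 1, by positivity, fun x => ?_⟩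
    have hx : (x : H) = D (T x - (r : ℂ) • (x : H)) :=
      ψ.ext_repr fun n => (hcoord x n (hr n)).symm
    calc ‖(x : H)‖ = ‖D (T x - (r : ℂ) • (x : H))‖ := congrArg _ hx
      _ ≤ ‖D‖ * ‖T x - (r : ℂ) • (x : H)‖ := D.le_opNorm _
      _ ≤ _ := by nlinarith [norm_nonneg (T x - (r : ℂ) • (x : H))]

include hp in
-- A self-adjoint part $A$ in $S$ inherits regularity, so $A-t_n$ maps onto $S$. But
-- $\operatorname{ran}(T-t_n)\perp\psi_n$; hence vectors of $S$ have all coordinates zero.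
theorem isSimple (hpair : IsBandlimitPair F t t') : IsSimple T := by
  rintro S hS hbot - ⟨A, hA, hgr⟩
  have hmem : ∀ u v : S, (u, v) ∈ A.graph → ∃ z : T.domain, (z : H) = u ∧ T z = v := by
    intro u v huv
    have h1 : ((u : H), (v : H)) ∈ (T.domRestrict S).graph := by
      rw [← hgr]
      exact ⟨(u, v), huv, rfl⟩
    have hle : T.domRestrict S ≤ T := LinearPMap.domRestrict_le
    exact T.mem_graph_iff.1 (LinearPMap.le_graph_of_le hle h1)
  refine hbot ((Submodule.eq_bot_iff _).2 fun v hv => ψ.ext_repr fun n => ?_)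
  obtain ⟨c, hc, hb⟩ := hT.isRegular hp hpair (t n)
  obtain ⟨x, hx⟩ := LinearPMap.exists_sub_smul_eq hA hc (r := t n) (fun x => by
    obtain ⟨z, hz, hz'⟩ := hmem _ _ (A.mem_graph x)
    have := hb z
    rw [hz, hz'] at this
    exact this) ⟨v, hv⟩
  obtain ⟨z, hz, hz'⟩ := hmem _ _ (A.mem_graph x)
  have hv' : v = T z - (t n : ℂ) • (z : H) := by
    rw [hz, hz']
    exact (congrArg Subtype.val hx).symm
  rw [hv', ψ.repr_sub, ψ.repr_smul, hT.repr_apply, sub_self, ψ.repr_zero]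

omit hT in
theorem _root_.BandlimitModel.mem_deficiencySpace_iff {T : H →ₗ.[ℂ] H} {z : ℂ} {x : H} :
    x ∈ deficiencySpace T z ↔
      ∀ a b, (a, b) ∈ T.graph → (inner ℂ (b - conj z • a) x : ℂ) = 0 := by
  simp only [deficiencySpace, Submodule.mem_comap, Submodule.mem_adjoint_iff]
  refine forall₃_congr fun a b _ => ?_
  rw [inner_sub_left, inner_smul_left, Complex.conj_conj]
  simp [inner_smul_right]

/-- The space is $\operatorname{ran}(T+i)^\perp$, and since $T_0+i$ is onto,
$\operatorname{ran}(T+i)$ is all of $\phi_+^\perp$. -/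
theorem deficiencySpace_I : deficiencySpace T Complex.I = ℂ ∙ φp := by
  refine le_antisymm (fun x hx => ?_) ?_
  · refine Submodule.mem_span_singleton_of_forall_inner_eq_zero fun w hw => ?_
    obtain ⟨a, b, hab, rfl⟩ := hT.exists_add_eq hw
    have := mem_deficiencySpace_iff.1 hx a b hab
    rwa [Complex.conj_I, neg_smul, sub_neg_eq_add] at this
  · rw [Submodule.span_singleton_le_iff_mem, mem_deficiencySpace_iff]
    intro a b hab
    rw [Complex.conj_I, neg_smul, sub_neg_eq_add, inner_eq_zero_symm]
    exact ((hT a b).1 hab).2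

include hp hm in
theorem deficiencySpace_neg_I : deficiencySpace T (-Complex.I) = ℂ ∙ φm := by
  refine le_antisymm (fun x hx => ?_) ?_
  · refine Submodule.mem_span_singleton_of_forall_inner_eq_zero fun w hw => ?_
    obtain ⟨a, b, hab, rfl⟩ := hT.exists_sub_eq hp hm hw
    have := mem_deficiencySpace_iff.1 hx a b hab
    rwa [map_neg, Complex.conj_I, neg_neg] at this
  · rw [Submodule.span_singleton_le_iff_mem, mem_deficiencySpace_iff]
    intro a b hab
    have h := (hT a b).1 hab
    rw [map_neg, Complex.conj_I, neg_neg, inner_eq_zero_symm, ← h.2]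
    refine ψ.inner_eq_of_repr fun n => ?_
    have e1 := ofReal_add_I_ne_zero (t n)
    have e2 := ofReal_sub_I_ne_zero (t n)
    rw [hp, hm, conj_div_sub_I, conj_div_add_I, ψ.repr_add, ψ.repr_sub, ψ.repr_smul, h.1]
    field_simp

include hp in
theorem isSR [CompleteSpace H] (hpair : IsBandlimitPair F t t') : IsSR T where
  separable := ψ.separableSpace
  closed := hT.isClosed
  symmetric := hT.isFormalAdjoint
  simple := hT.isSimple hp hpair
  regular := hT.isRegular hp hpair
  index_plus := by
    rw [hT.deficiencySpace_I]
    exact finrank_span_singleton (hpair.ne_zero_of_repr hp)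
  index_minus := by
    -- The vector $\phi_-$ is built from the current basis, so only the coordinates of $\phi_+$ need
    -- transporting to the model.
    rw [hT.deficiencySpace_neg_I hp (hpair.repr_phiMinus ψ)]
    refine finrank_span_singleton fun h => ?_
    obtain ⟨n⟩ := hpair.nonempty
    have := hpair.repr_phiMinus ψ n
    rw [h, ψ.repr_zero] at this
    exact div_ne_zero (hpair.sqrt_ne_zero n) (ofReal_add_I_ne_zero _) this.symm

end IsNodeRestriction

end BandlimitModel

/-! ### Passage to coordinates, unitary transport, and the extensions $T_\theta$ -/

namespace BandlimitModel

open scoped InnerProductSpace ComplexConjugate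

section Model

variable {ι H : Type*} [NormedAddCommGroup H] [InnerProductSpace ℂ H]

/-- Pairing with the eigenvectors gives one direction. For the other, a pair with these coordinates
satisfies the adjoint relation against the whole graph of $T_0$, and $T_0^*=T_0$. -/
theorem mem_graph_iff_repr [CompleteSpace H] {t : ι → ℝ} {ψ : HilbertBasis ι ℂ H}
    {T₀ : H →ₗ.[ℂ] H} (hT₀ : IsSelfAdjoint T₀)
    (hψ : ∀ n, (ψ n, (t n : ℂ) • ψ n) ∈ T₀.graph) {x y : H} :
    (x, y) ∈ T₀.graph ↔ ∀ n, ψ.repr y n = t n * ψ.repr x n := by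
  have e : T₀.graph = T₀.graph.adjoint := by
    rw [← LinearPMap.adjoint_graph_eq_graph_adjoint hT₀.dense_domain,
      LinearPMap.isSelfAdjoint_def.1 hT₀]
  have h1 : ∀ {x y : H}, (x, y) ∈ T₀.graph → ∀ n, ψ.repr y n = t n * ψ.repr x n := by
    intro x y hxy n
    rw [e, Submodule.mem_adjoint_iff] at hxy
    have := hxy _ _ (hψ n)
    rw [inner_smul_left, Complex.conj_ofReal, ← ψ.repr_apply_apply, ← ψ.repr_apply_apply] at this
    exact (sub_eq_zero.1 this).symm
  refine ⟨h1, fun h => ?_⟩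
  rw [e, Submodule.mem_adjoint_iff]
  intro a b hab
  rw [sub_eq_zero]
  refine ψ.inner_eq_of_repr fun n => ?_
  simp only [h, h1 hab, map_mul, Complex.conj_ofReal]
  ring

theorem mem_graph_symRestrict {T₀ : H →ₗ.[ℂ] H} {φp x y : H} :
    (x, y) ∈ (symRestrict T₀ φp).graph ↔
      (x, y) ∈ T₀.graph ∧ (inner ℂ φp (y + Complex.I • x) : ℂ) = 0 := by
  constructor
  · intro h
    have hle : symRestrict T₀ φp ≤ T₀ := LinearPMap.domRestrict_le
    have h0 := LinearPMap.le_graph_of_le hle h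
    refine ⟨h0, ?_⟩
    obtain ⟨z, hz, hz'⟩ := Submodule.mem_map.1 (LinearPMap.mem_domain_of_mem_graph h).1
    obtain ⟨w, hw, hw'⟩ := T₀.mem_graph_iff.1 h0
    have : z = w := Subtype.ext (hz'.trans hw.symm)
    subst this
    simp only at hw hw'
    rw [← hw, ← hw']
    exact hz
  · rintro ⟨h, h0⟩
    obtain ⟨w, hw, hw'⟩ := T₀.mem_graph_iff.1 h
    simp only at hw hw'
    subst hw hw'
    refine LinearPMap.mem_graph_iff _ |>.2 ⟨⟨w, ⟨w, h0, rfl⟩, w.2⟩, rfl, ?_⟩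
    exact LinearPMap.domRestrict_apply rfl

theorem isNodeRestriction_symRestrict [CompleteSpace H] {t : ι → ℝ} {ψ : HilbertBasis ι ℂ H}
    {T₀ : H →ₗ.[ℂ] H} (hT₀ : IsSelfAdjoint T₀)
    (hψ : ∀ n, (ψ n, (t n : ℂ) • ψ n) ∈ T₀.graph) (φp : H) :
    IsNodeRestriction t ψ φp (symRestrict T₀ φp) := fun _ _ => by
  rw [mem_graph_symRestrict, mem_graph_iff_repr hT₀ hψ]

variable {K : Type*} [NormedAddCommGroup K] [InnerProductSpace ℂ K]

theorem mem_graph_unitaryConj (U : H ≃ₗᵢ[ℂ] K) (T : H →ₗ.[ℂ] H) {x y : K} :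
    (x, y) ∈ (unitaryConj U T).graph ↔ (U.symm x, U.symm y) ∈ T.graph := by
  rw [LinearPMap.mem_graph_iff, LinearPMap.mem_graph_iff]
  constructor
  · rintro ⟨⟨z, hz⟩, h1, h2⟩
    simp only at h1 h2
    subst h1 h2
    exact ⟨⟨U.symm z, hz⟩, rfl, (U.symm_apply_apply _).symm⟩
  · rintro ⟨⟨z, hz⟩, h1, h2⟩
    simp only at h1 h2
    subst h1
    refine ⟨⟨x, hz⟩, rfl, ?_⟩
    have : unitaryConj U T ⟨x, hz⟩ = U (T ⟨U.symm x, hz⟩) := rfl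
    rw [this, h2, U.apply_symm_apply]

theorem IsNodeRestriction.unitaryConj {t : ι → ℝ} {ψ : HilbertBasis ι ℂ H} {φp : H}
    {T : H →ₗ.[ℂ] H} (hT : IsNodeRestriction t ψ φp T) (U : H ≃ₗᵢ[ℂ] K) :
    IsNodeRestriction t (ψ.mapIsometryEquiv U) (U φp) (unitaryConj U T) := fun x y => by
  rw [mem_graph_unitaryConj, hT]
  refine and_congr Iff.rfl ?_
  rw [← U.inner_map_map, map_add, map_smul, U.apply_symm_apply, U.apply_symm_apply]

end Model

variable {H : Type*} [NormedAddCommGroup H] [InnerProductSpace ℂ H]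
variable {F : Set ℤ} {t t' : F → ℝ} {ψ : HilbertBasis F ℂ H} {φp φm : H} {T : H →ₗ.[ℂ] H}

theorem mem_cayley_iff {x y : H} : (x, y) ∈ cayley T ↔
    ∃ u v w, (u, v) ∈ T.graph ∧
      (∀ a b, (a, b) ∈ T.graph → (inner ℂ (b + Complex.I • a) w : ℂ) = 0) ∧
      x = v + Complex.I • u + w ∧ y = v - Complex.I • u := by
  simp only [cayley, Submodule.mem_sup, Submodule.mem_map, Submodule.mem_prod,
    Submodule.mem_orthogonal, Prod.exists, Submodule.mem_bot]
  constructor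
  · rintro ⟨_, _, ⟨u, v, huv, h1⟩, w, z, ⟨hw, rfl⟩, h2⟩
    obtain ⟨rfl, rfl⟩ := Prod.mk.inj h1
    simp only [Prod.mk_add_mk, Prod.mk.injEq, add_zero] at h2
    exact ⟨u, v, w, huv, fun a b hab => hw _ ⟨a, b, hab, rfl⟩, h2.1.symm, h2.2.symm⟩
  · rintro ⟨u, v, w, huv, hw, rfl, rfl⟩
    refine ⟨_, _, ⟨u, v, huv, rfl⟩, w, 0, ⟨?_, rfl⟩, ?_⟩
    · rintro _ ⟨a, b, hab, rfl⟩
      exact hw a b hab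
    · simp

theorem mem_unitaryExt_iff {θ : ℝ} {x y : H} : (x, y) ∈ unitaryExt T φp φm θ ↔
    ∃ y₀, (x, y₀) ∈ cayley T ∧ y = y₀ +
      (Complex.exp (2 * Real.pi * Complex.I * θ) / (‖φp‖ : ℂ) ^ 2) •
        ((inner ℂ φp x : ℂ) • φm) := by
  simp only [unitaryExt, Submodule.mem_map, Prod.exists]
  constructor
  · rintro ⟨a, b, hab, h⟩
    obtain ⟨rfl, rfl⟩ := Prod.mk.inj h
    exact ⟨b, hab, rfl⟩
  · rintro ⟨y₀, h, rfl⟩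
    exact ⟨x, y₀, h, rfl⟩

theorem mem_selfAdjointExt_iff {θ s : ℝ} {v : H} :
    (v, (s : ℂ) • v) ∈ selfAdjointExt T φp φm θ ↔
      (((s : ℂ) + Complex.I) • v, ((s : ℂ) - Complex.I) • v) ∈ unitaryExt T φp φm θ := by
  have hI : (2 * Complex.I : ℂ) ≠ 0 := mul_ne_zero two_ne_zero Complex.I_ne_zero
  simp only [selfAdjointExt, Submodule.mem_map, Prod.exists]
  constructor
  · rintro ⟨a, b, hab, h⟩
    have hv : a - b = v := congrArg Prod.fst h
    replace h : Complex.I • (a + b) = (s : ℂ) • v := congrArg Prod.snd h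
    subst hv
    have e := Submodule.smul_mem _ (2 * Complex.I) hab
    have h1 : (2 * Complex.I) • a = ((s : ℂ) + Complex.I) • (a - b) := by
      rw [add_smul, ← h]; module
    have h2 : (2 * Complex.I) • b = ((s : ℂ) - Complex.I) • (a - b) := by
      rw [sub_smul, ← h]; module
    rwa [Prod.smul_mk, h1, h2] at e
  · intro h
    refine ⟨_, _, Submodule.smul_mem _ (2 * Complex.I)⁻¹ h, ?_⟩
    refine Prod.ext ?_ ?_
    · change (2 * Complex.I)⁻¹ • ((s : ℂ) + Complex.I) • v -
        (2 * Complex.I)⁻¹ • ((s : ℂ) - Complex.I) • v = v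
      rw [← smul_sub, ← sub_smul, smul_smul,
        show (2 * Complex.I)⁻¹ * ((s : ℂ) + Complex.I - (s - Complex.I)) = 1 by field_simp; ring,
        one_smul]
    · change Complex.I • ((2 * Complex.I)⁻¹ • ((s : ℂ) + Complex.I) • v +
        (2 * Complex.I)⁻¹ • ((s : ℂ) - Complex.I) • v) = (s : ℂ) • v
      rw [← smul_add, ← add_smul, smul_smul, smul_smul]
      congr 1
      field_simp
      ring

namespace IsNodeRestriction

variable (hT : IsNodeRestriction t ψ φp T)
  (hp : ∀ n, ψ.repr φp n = Real.sqrt (t' n) / ((t n : ℂ) - Complex.I))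
  (hm : ∀ n, ψ.repr φm n = Real.sqrt (t' n) / ((t n : ℂ) + Complex.I))
include hT hp hm

/-- This is $U_\theta=b(T_0)+(e^{2\pi i\theta}-1)\|\phi_+\|^{-2}\langle\phi_+,\cdot\rangle\phi_-$
with denominators cleared: $b(T_0)$ agrees with $V$ on $\phi_+^\perp$ and sends $\phi_+$ to
$\phi_-$. -/
theorem mem_unitaryExt_iff_repr (h0 : φp ≠ 0) {θ : ℝ} {x y : H} :
    (x, y) ∈ unitaryExt T φp φm θ ↔ ∀ n, ((t n : ℂ) + Complex.I) * ψ.repr y n =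
      ((t n : ℂ) - Complex.I) * ψ.repr x n +
        (Complex.exp (2 * Real.pi * Complex.I * θ) - 1) *
          ((inner ℂ φp x : ℂ) / (‖φp‖ : ℂ) ^ 2) * Real.sqrt (t' n) := by
  have hn0 : (‖φp‖ : ℂ) ≠ 0 := by simpa using h0
  have hpp : (inner ℂ φp φp : ℂ) = (‖φp‖ : ℂ) ^ 2 := inner_self_eq_norm_sq_to_K φp
  rw [mem_unitaryExt_iff]
  constructor
  · rintro ⟨y₀, hc, rfl⟩ n
    obtain ⟨u, v, w, huv, hw, rfl, rfl⟩ := mem_cayley_iff.1 hc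
    have hw' : w ∈ ℂ ∙ φp := Submodule.mem_span_singleton_of_forall_inner_eq_zero fun z hz => by
      obtain ⟨a, b, hab, rfl⟩ := hT.exists_add_eq hz
      exact hw a b hab
    obtain ⟨c, rfl⟩ := Submodule.mem_span_singleton.1 hw'
    have h := (hT u v).1 huv
    have e1 := ofReal_add_I_ne_zero (t n)
    have e2 := ofReal_sub_I_ne_zero (t n)
    rw [inner_add_right, h.2, inner_smul_right, hpp]
    simp only [ψ.repr_add, ψ.repr_sub, ψ.repr_smul, hp, hm, h.1]
    field_simp
    ring
  · intro h
    set c : ℂ := (inner ℂ φp x : ℂ) / (‖φp‖ : ℂ) ^ 2 with hc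
    have hperp : (inner ℂ φp (x - c • φp) : ℂ) = 0 := by
      rw [inner_sub_right, inner_smul_right, hpp, hc, div_mul_cancel₀ _ (pow_ne_zero 2 hn0),
        sub_self]
    obtain ⟨u, v, huv, hx⟩ := hT.exists_add_eq hperp
    refine ⟨v - Complex.I • u, mem_cayley_iff.2 ⟨u, v, c • φp, huv, fun a b hab => ?_, ?_, rfl⟩, ?_⟩
    · rw [inner_smul_right, inner_eq_zero_symm.1 ((hT a b).1 hab).2, mul_zero]
    · rw [hx, sub_add_cancel]
    · have hxe : x = v + Complex.I • u + c • φp := by rw [hx, sub_add_cancel]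
      have hco := (hT u v).1 huv
      refine ψ.ext_repr fun n => ?_
      have e1 := ofReal_add_I_ne_zero (t n)
      have e2 := ofReal_sub_I_ne_zero (t n)
      have hxn := congrArg (fun z => ψ.repr z n) hxe
      simp only [ψ.repr_add, ψ.repr_smul, hp, hco.1] at hxn
      have hn := h n
      rw [hxn] at hn
      refine mul_left_cancel₀ e1 ?_
      have hcoef : Complex.exp (2 * Real.pi * Complex.I * θ) / (‖φp‖ : ℂ) ^ 2 * inner ℂ φp x =
          Complex.exp (2 * Real.pi * Complex.I * θ) * c := by rw [hc]; ring
      rw [hn, smul_smul, hcoef]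
      simp only [ψ.repr_add, ψ.repr_sub, ψ.repr_smul, hm, hco.1]
      field_simp
      ring

theorem mem_selfAdjointExt_iff_repr (h0 : φp ≠ 0) {θ s : ℝ} {v : H} :
    (v, (s : ℂ) • v) ∈ selfAdjointExt T φp φm θ ↔
      ∀ n, 2 * Complex.I * ((s - t n) * ψ.repr v n) =
        (Complex.exp (2 * Real.pi * Complex.I * θ) - 1) *
          (((s : ℂ) + Complex.I) * inner ℂ φp v / (‖φp‖ : ℂ) ^ 2) * Real.sqrt (t' n) := by
  rw [mem_selfAdjointExt_iff, hT.mem_unitaryExt_iff_repr hp hm h0]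
  refine forall_congr' fun n => ?_
  -- The left side collapses through $(t_n+i)(s-i)-(t_n-i)(s+i)=2i(s-t_n)$.
  rw [ψ.repr_smul, ψ.repr_smul, inner_smul_right, ← sub_eq_iff_eq_add']
  refine Eq.congr ?_ rfl
  ring

end IsNodeRestriction

end BandlimitModel

/-! ### Eigenvectors of the extensions and the phase function -/

namespace BandlimitModel

open scoped InnerProductSpace ComplexConjugate

theorem exp_two_pi_I_mul_injOn {θ θ' : ℝ} (hθ : θ ∈ Set.Ico (0 : ℝ) 1)
    (hθ' : θ' ∈ Set.Ico (0 : ℝ) 1)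
    (h : Complex.exp (2 * Real.pi * Complex.I * θ) = Complex.exp (2 * Real.pi * Complex.I * θ')) :
    θ = θ' := by
  obtain ⟨k, hk⟩ := Complex.exp_eq_exp_iff_exists_int.1 h
  have h0 : (2 * Real.pi * Complex.I : ℂ) ≠ 0 := Complex.two_pi_I_ne_zero
  have h1 : (θ : ℂ) = θ' + k := mul_left_cancel₀ h0 (by rw [hk]; ring)
  have h2 : θ = θ' + k := by exact_mod_cast h1
  have h3 : (k : ℝ) < 1 := by linarith [hθ.2, hθ'.1]
  have h4 : (-1 : ℝ) < k := by linarith [hθ.1, hθ'.2]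
  have h5 : k = 0 := by
    have : k < 1 := by exact_mod_cast h3
    have : -1 < k := by exact_mod_cast h4
    omega
  rw [h2, h5, Int.cast_zero, add_zero]

theorem exists_exp_two_pi_I_mul_eq {z : ℂ} (hz : ‖z‖ = 1) :
    ∃ θ ∈ Set.Ico (0 : ℝ) 1, Complex.exp (2 * Real.pi * Complex.I * θ) = z := by
  refine ⟨Int.fract (z.arg / (2 * Real.pi)), ⟨Int.fract_nonneg _, Int.fract_lt_one _⟩, ?_⟩
  have hpi : (Real.pi : ℂ) ≠ 0 := by exact_mod_cast Real.pi_ne_zero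
  have e : (2 * Real.pi * Complex.I * ((Int.fract (z.arg / (2 * Real.pi)) : ℝ) : ℂ)) =
      z.arg * Complex.I - (⌊z.arg / (2 * Real.pi)⌋ : ℤ) * (2 * Real.pi * Complex.I) := by
    rw [Int.fract]
    push_cast
    field_simp
  rw [e, Complex.exp_periodic.sub_int_mul_eq]
  have := Complex.norm_mul_exp_arg_mul_I z
  rwa [hz, Complex.ofReal_one, one_mul] at this

variable {H : Type*} [NormedAddCommGroup H] [InnerProductSpace ℂ H]
variable {F : Set ℤ} {t t' : F → ℝ} {ψ : HilbertBasis F ℂ H} {φp φm : H} {T : H →ₗ.[ℂ] H}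

/-- The vector `∑ √t'ₙ / (s - tₙ) ψₙ`; if `s` is a node then the corresponding term is absent. -/
noncomputable def cauchyVec (t t' : F → ℝ) (ψ : HilbertBasis F ℂ H) (s : ℝ) : H :=
  ∑' n, ((Real.sqrt (t' n) : ℂ) / ((s : ℂ) - t n)) • ψ n

theorem IsBandlimitPair.norm_sq_sqrt_div (h : IsBandlimitPair F t t') (s : ℝ) (n : F) :
    ‖(Real.sqrt (t' n) : ℂ) / ((s : ℂ) - t n)‖ ^ 2 = t' n / (s - t n) ^ 2 := by
  rw [← Complex.ofReal_sub, ← Complex.ofReal_div, Complex.norm_real, Real.norm_eq_abs, sq_abs,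
    div_pow, Real.sq_sqrt (h.pos n).le]

theorem IsBandlimitPair.repr_cauchyVec (h : IsBandlimitPair F t t') (ψ : HilbertBasis F ℂ H)
    (s : ℝ) (n : F) :
    ψ.repr (cauchyVec t t' ψ s) n = (Real.sqrt (t' n) : ℂ) / ((s : ℂ) - t n) :=
  ψ.repr_tsum_smul ((h.summable_div_sub_sq s).congr fun n => (h.norm_sq_sqrt_div s n).symm) n

theorem IsBandlimitPair.weight_eq (h : IsBandlimitPair F t t') (ψ : HilbertBasis F ℂ H) (s : ℝ) :
    weight t t' s = ‖cauchyVec t t' ψ s‖⁻¹ := by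
  have e : ∑' n, t' n / (s - t n) ^ 2 = ‖cauchyVec t t' ψ s‖ ^ 2 := by
    rw [← (ψ.hasSum_norm_sq_repr (cauchyVec t t' ψ s)).tsum_eq]
    refine tsum_congr fun n => ?_
    rw [h.repr_cauchyVec, h.norm_sq_sqrt_div]
  rw [weight, e, Real.sqrt_sq (norm_nonneg _)]

theorem ofReal_sub_ne_zero {s a : ℝ} (h : a ≠ s) : (s : ℂ) - a ≠ 0 := by
  rw [← Complex.ofReal_sub, Complex.ofReal_ne_zero]
  exact sub_ne_zero.2 h.symm

theorem IsBandlimitPair.cauchyVec_ne_zero (h : IsBandlimitPair F t t') (ψ : HilbertBasis F ℂ H)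
    {s : ℝ} (hs : ∀ n, t n ≠ s) : cauchyVec t t' ψ s ≠ 0 := fun h0 => by
  obtain ⟨n⟩ := h.nonempty
  have := h.repr_cauchyVec ψ s n
  rw [h0, ψ.repr_zero] at this
  exact div_ne_zero (h.sqrt_ne_zero n) (ofReal_sub_ne_zero (hs n)) this.symm

/-- The imaginary part of `(s + i) ⟨φ₊, ∑ √t'ₙ / (s - tₙ) ψₙ⟩`. -/
theorem IsBandlimitPair.im_inner_cauchyVec (h : IsBandlimitPair F t t')
    (hp : ∀ n, ψ.repr φp n = Real.sqrt (t' n) / ((t n : ℂ) - Complex.I)) {s : ℝ}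
    (hs : ∀ n, t n ≠ s) :
    (((s : ℂ) + Complex.I) * inner ℂ φp (cauchyVec t t' ψ s)).im = -‖φp‖ ^ 2 := by
  have h1 := Complex.imCLM.hasSum
    ((ψ.hasSum_conj_repr_mul_repr φp (cauchyVec t t' ψ s)).mul_left ((s : ℂ) + Complex.I))
  refine h1.unique ((ψ.hasSum_norm_sq_repr φp).neg.congr_fun fun n => ?_)
  have e1 := ofReal_add_I_ne_zero (t n)
  have e2 := ofReal_sub_ne_zero (hs n)
  have e3 : (0 : ℝ) < 1 + t n ^ 2 := by positivity
  have e4 : s - t n ≠ 0 := sub_ne_zero.2 (hs n).symm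
  -- Writing $s+i=(s-t_n)+(t_n+i)$ splits the term as $t_n'\big((t_n+i)^{-1}+(s-t_n)^{-1}\big)$;
  -- only the first summand has an imaginary part.
  have key : ((s : ℂ) + Complex.I) * (conj (ψ.repr φp n) * ψ.repr (cauchyVec t t' ψ s) n) =
      ((t' n * (1 + t n * s) / ((s - t n) * (1 + t n ^ 2)) : ℝ) : ℂ) -
        ((t' n / (1 + t n ^ 2) : ℝ) : ℂ) * Complex.I := by
    rw [hp, h.repr_cauchyVec, conj_div_sub_I, div_mul_div_comm, ← Complex.ofReal_mul,
      Real.mul_self_sqrt (h.pos n).le]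
    have e6 : (1 + (t n : ℂ) ^ 2) ≠ 0 := by exact_mod_cast e3.ne'
    push_cast
    have e7 : (1 + (t n : ℂ) ^ 2) = (t n + Complex.I) * (t n - Complex.I) := by
      linear_combination Complex.I_sq
    have e8 := ofReal_sub_I_ne_zero (t n)
    rw [e7]
    field_simp
    linear_combination (-(t' n : ℂ)) * Complex.I_sq
  simp only [Complex.imCLM_apply]
  rw [key, hp, norm_div, div_pow, norm_sq_ofReal_sub_I, Complex.norm_real, Real.norm_eq_abs,
    sq_abs, Real.sq_sqrt (h.pos n).le, Complex.sub_im, Complex.ofReal_im, Complex.im_ofReal_mul,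
    Complex.I_im, mul_one, zero_sub]

/-- The coordinates of the eigenvectors with eigenvalue `s` of the self-adjoint extensions. -/
def HasEigenCoords (t t' : F → ℝ) (ψ : HilbertBasis F ℂ H) (s : ℝ) (v : H) : Prop :=
  ∃ c : ℂ, ∀ n, ((s : ℂ) - t n) * ψ.repr v n = c * Real.sqrt (t' n)

/-- The equation at $n=m$ forces the constant $c$ to vanish, and then all other coordinates vanish.
-/
theorem HasEigenCoords.eq_smul_basis (h : IsBandlimitPair F t t') {m : F} {v : H}
    (hv : HasEigenCoords t t' ψ (t m) v) : v = ψ.repr v m • ψ m := by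
  obtain ⟨c, hc⟩ := hv
  have hc0 : c = 0 := by
    have := hc m
    rw [sub_self, zero_mul] at this
    exact (mul_eq_zero.1 this.symm).resolve_right (h.sqrt_ne_zero m)
  refine ψ.eq_smul_basis fun n hn => ?_
  have := hc n
  rw [hc0, zero_mul] at this
  exact (mul_eq_zero.1 this).resolve_left
    (ofReal_sub_ne_zero fun e => hn (h.strictMono.injective e))

theorem HasEigenCoords.exists_eq_smul_cauchyVec (h : IsBandlimitPair F t t') {s : ℝ}
    (hs : ∀ n, t n ≠ s) {v : H} (hv : HasEigenCoords t t' ψ s v) :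
    ∃ c : ℂ, v = c • cauchyVec t t' ψ s := by
  obtain ⟨c, hc⟩ := hv
  refine ⟨c, ψ.ext_repr fun n => ?_⟩
  have e2 := ofReal_sub_ne_zero (hs n)
  rw [ψ.repr_smul, h.repr_cauchyVec, ← mul_div_assoc, eq_div_iff e2, ← hc, mul_comm]

theorem hasEigenCoords_smul_basis (m : F) (c : ℂ) :
    HasEigenCoords t t' ψ (t m) (c • ψ m) := by
  refine ⟨0, fun n => ?_⟩
  rw [ψ.repr_smul, zero_mul]
  by_cases hn : n = m
  · rw [hn, sub_self, zero_mul]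
  · rw [ψ.repr_basis_of_ne hn, mul_zero, mul_zero]

theorem hasEigenCoords_smul_cauchyVec (h : IsBandlimitPair F t t') {s : ℝ}
    (hs : ∀ n, t n ≠ s) (c : ℂ) : HasEigenCoords t t' ψ s (c • cauchyVec t t' ψ s) := by
  refine ⟨c, fun n => ?_⟩
  have e2 := ofReal_sub_ne_zero (hs n)
  rw [ψ.repr_smul, h.repr_cauchyVec]
  field_simp

theorem exists_hasEigenCoords (h : IsBandlimitPair F t t') (ψ : HilbertBasis F ℂ H) (s : ℝ) :
    ∃ v, v ≠ 0 ∧ HasEigenCoords t t' ψ s v := by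
  by_cases hs : ∃ m, t m = s
  · obtain ⟨m, rfl⟩ := hs
    exact ⟨(1 : ℂ) • ψ m, by rw [one_smul]; exact ψ.orthonormal.ne_zero m,
      hasEigenCoords_smul_basis m 1⟩
  · push Not at hs
    exact ⟨(1 : ℂ) • cauchyVec t t' ψ s, by rw [one_smul]; exact h.cauchyVec_ne_zero ψ hs,
      hasEigenCoords_smul_cauchyVec h hs 1⟩

namespace IsNodeRestriction

variable (hT : IsNodeRestriction t ψ φp T) (h : IsBandlimitPair F t t')
  (hp : ∀ n, ψ.repr φp n = Real.sqrt (t' n) / ((t n : ℂ) - Complex.I))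
  (hm : ∀ n, ψ.repr φm n = Real.sqrt (t' n) / ((t n : ℂ) + Complex.I))
include hT h hp hm

theorem hasEigenCoords_of_mem {θ s : ℝ} {v : H}
    (hv : (v, (s : ℂ) • v) ∈ selfAdjointExt T φp φm θ) : HasEigenCoords t t' ψ s v := by
  have hI : (2 * Complex.I : ℂ) ≠ 0 := mul_ne_zero two_ne_zero Complex.I_ne_zero
  rw [hT.mem_selfAdjointExt_iff_repr hp hm (h.ne_zero_of_repr hp)] at hv
  refine ⟨(2 * Complex.I)⁻¹ * ((Complex.exp (2 * Real.pi * Complex.I * θ) - 1) *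
    (((s : ℂ) + Complex.I) * inner ℂ φp v / (‖φp‖ : ℂ) ^ 2)), fun n => ?_⟩
  rw [mul_assoc, ← hv n, inv_mul_cancel_left₀ hI]

/-- Every real number is an eigenvalue of exactly one self-adjoint extension. -/
theorem exists_eigenvalue_parameter (s : ℝ) : ∃ θ₀ ∈ Set.Ico (0 : ℝ) 1,
    ∀ θ ∈ Set.Ico (0 : ℝ) 1, ∀ v : H, v ≠ 0 →
      ((v, (s : ℂ) • v) ∈ selfAdjointExt T φp φm θ ↔ θ = θ₀ ∧ HasEigenCoords t t' ψ s v) := by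
  have h0 := h.ne_zero_of_repr hp
  have hn0 : (‖φp‖ : ℂ) ≠ 0 := by simpa using h0
  by_cases hs : ∃ m, t m = s
  · obtain ⟨m, rfl⟩ := hs
    -- At a node $v$ is a multiple of $\psi_m$, which is not orthogonal to $\phi_+$; coordinate $m$
    -- then forces $e^{2\pi i\theta}=1$.
    refine ⟨0, by simp, fun θ hθ v hv0 => ⟨fun hv => ?_, ?_⟩⟩
    · have hc := hT.hasEigenCoords_of_mem h hp hm hv
      refine ⟨?_, hc⟩
      rw [hT.mem_selfAdjointExt_iff_repr hp hm h0] at hv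
      have hvm := hv m
      have e := hc.eq_smul_basis h
      have hne : (inner ℂ φp v : ℂ) ≠ 0 := by
        rw [e, inner_smul_right, ← inner_conj_symm, ← ψ.repr_apply_apply, hp, conj_div_sub_I]
        refine mul_ne_zero (fun hz => hv0 ?_)
          (div_ne_zero (h.sqrt_ne_zero m) (ofReal_add_I_ne_zero _))
        rw [e, hz, zero_smul]
      rw [sub_self, zero_mul, mul_zero] at hvm
      have h1 := (mul_eq_zero.1 hvm.symm).resolve_right (h.sqrt_ne_zero m)
      have h2 := (mul_eq_zero.1 h1).resolve_right
        (div_ne_zero (mul_ne_zero (ofReal_add_I_ne_zero _) hne) (pow_ne_zero 2 hn0))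
      refine exp_two_pi_I_mul_injOn hθ (by simp) ?_
      rw [sub_eq_zero.1 h2, Complex.ofReal_zero, mul_zero, Complex.exp_zero]
    · rintro ⟨rfl, hc⟩
      rw [hT.mem_selfAdjointExt_iff_repr hp hm h0]
      intro n
      rw [Complex.ofReal_zero, mul_zero, Complex.exp_zero, sub_self, zero_mul, zero_mul,
        hc.eq_smul_basis h, ψ.repr_smul]
      by_cases hn : n = m
      · rw [hn, sub_self, zero_mul, mul_zero]
      · rw [ψ.repr_basis_of_ne hn, mul_zero, mul_zero, mul_zero]
  · push Not at hs
    set g := cauchyVec t t' ψ s with hg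
    set d : ℂ := ((s : ℂ) + Complex.I) * inner ℂ φp g with hd
    have him : d.im = -‖φp‖ ^ 2 := h.im_inner_cauchyVec hp hs
    have hd0 : d ≠ 0 := fun hz => by
      rw [hz, Complex.zero_im] at him
      have := norm_pos_iff.2 h0
      nlinarith
    -- The eigenvalue equation for $g$ reads $2i\|\phi_+\|^2=(e^{2\pi i\theta}-1)d$. With the known
    -- imaginary part of $d$ its solution is $e^{2\pi i\theta}=\bar d/d$, which is unimodular.
    have hconj : conj d = d + 2 * Complex.I * (‖φp‖ : ℂ) ^ 2 := by
      apply Complex.ext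
      · simp [← Complex.ofReal_pow]
      · simp [← Complex.ofReal_pow, him]
        ring
    obtain ⟨θ₀, hθ₀, hexp⟩ := exists_exp_two_pi_I_mul_eq (z := conj d / d) (by
      rw [norm_div, RCLike.norm_conj, div_self (norm_ne_zero_iff.2 hd0)])
    have key : ∀ θ : ℝ, ∀ c : ℂ, c ≠ 0 →
        ((c • g, (s : ℂ) • (c • g)) ∈ selfAdjointExt T φp φm θ ↔
          Complex.exp (2 * Real.pi * Complex.I * θ) = conj d / d) := by
      intro θ c hc
      rw [hT.mem_selfAdjointExt_iff_repr hp hm h0]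
      have hterm : ∀ n, ((s : ℂ) - t n) * ψ.repr (c • g) n = c * Real.sqrt (t' n) := fun n => by
        have e2 := ofReal_sub_ne_zero (hs n)
        rw [ψ.repr_smul, h.repr_cauchyVec]
        field_simp
      have hin : ((s : ℂ) + Complex.I) * inner ℂ φp (c • g) = c * d := by
        rw [inner_smul_right, hd]; ring
      simp only [hterm, hin]
      rw [eq_div_iff hd0, hconj]
      clear_value d
      generalize Complex.exp (2 * Real.pi * Complex.I * θ) = z
      constructor
      · intro H
        obtain ⟨n⟩ := h.nonempty
        have H1 := H n
        have hsq := h.sqrt_ne_zero n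
        field_simp at H1
        linear_combination -H1
      · intro H n
        field_simp
        linear_combination (-(Real.sqrt (t' n) : ℂ)) * H
    refine ⟨θ₀, hθ₀, fun θ hθ v hv0 => ⟨fun hv => ?_, ?_⟩⟩
    · have hc := hT.hasEigenCoords_of_mem h hp hm hv
      refine ⟨?_, hc⟩
      obtain ⟨c, rfl⟩ := hc.exists_eq_smul_cauchyVec h hs
      have hc0 : c ≠ 0 := fun hz => hv0 (by rw [hz, zero_smul])
      exact exp_two_pi_I_mul_injOn hθ hθ₀ (((key θ c hc0).1 hv).trans hexp.symm)
    · rintro ⟨rfl, hc⟩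
      obtain ⟨c, rfl⟩ := hc.exists_eq_smul_cauchyVec h hs
      have hc0 : c ≠ 0 := fun hz => hv0 (by rw [hz, zero_smul])
      exact (key θ c hc0).2 hexp

theorem exists_phase_eq (s : ℝ) : ∃ θ₀ ∈ Set.Ico (0 : ℝ) 1,
    phase t T φp φm s = nodeIndex t s + θ₀ ∧
    ∀ v : H, v ≠ 0 →
      ((v, (s : ℂ) • v) ∈ selfAdjointExt T φp φm θ₀ ↔ HasEigenCoords t t' ψ s v) := by
  obtain ⟨θ₀, hθ₀, hθ⟩ := hT.exists_eigenvalue_parameter h hp hm s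
  refine ⟨θ₀, hθ₀, ?_, fun v hv => (hθ θ₀ hθ₀ v hv).trans (and_iff_right rfl)⟩
  have e : {θ : ℝ | θ ∈ Set.Ico 0 1 ∧ s ∈ realEigenvalues T φp φm θ} = {θ₀} := by
    ext θ
    constructor
    · rintro ⟨h1, v, hv, hv'⟩
      exact ((hθ θ h1 v hv).1 hv').1
    · rintro rfl
      obtain ⟨v, hv, hv'⟩ := exists_hasEigenCoords h ψ s
      exact ⟨hθ₀, v, hv, (hθ θ hθ₀ v hv).2 ⟨rfl, hv'⟩⟩
  rw [phase, e, csInf_singleton]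

theorem floor_phase (s : ℝ) : ⌊phase t T φp φm s⌋ = nodeIndex t s := by
  obtain ⟨θ₀, hθ₀, e, -⟩ := hT.exists_phase_eq h hp hm s
  rw [e, Int.floor_intCast_add, Int.floor_eq_zero_iff.2 hθ₀, add_zero]

theorem isEigenvectorFamily_iff {φ : ℝ → H} : IsEigenvectorFamily t T φp φm φ ↔
    ∀ s, ‖φ s‖ = 1 ∧ HasEigenCoords t t' ψ s (φ s) := by
  refine forall_congr' fun s => and_congr_right fun hn => ?_
  obtain ⟨θ₀, hθ₀, e, hθ⟩ := hT.exists_phase_eq h hp hm s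
  rw [e, Int.fract_intCast_add, Int.fract_eq_self.2 hθ₀]
  exact hθ _ (norm_ne_zero_iff.1 (by rw [hn]; exact one_ne_zero))

end IsNodeRestriction

end BandlimitModel

/-! ### The smooth choice of eigenvectors and its kernel -/

namespace BandlimitModel

open scoped InnerProductSpace ComplexConjugate

variable {H : Type*} [NormedAddCommGroup H] [InnerProductSpace ℂ H]
variable {F : Set ℤ} {t t' : F → ℝ} {ψ : HilbertBasis F ℂ H} {φp φm : H} {T : H →ₗ.[ℂ] H}

open scoped Classical in
/-- The unit eigenvectors for which the kernel `⟨φ_r, φ_s⟩` is real and smooth. -/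
noncomputable def eigenvector (t t' : F → ℝ) (ψ : HilbertBasis F ℂ H) (s : ℝ) : H :=
  if h : ∃ m, t m = s then (((-1 : ℝ) ^ nodeIndex t s : ℝ) : ℂ) • ψ h.choose
  else (((-1 : ℝ) ^ nodeIndex t s * weight t t' s : ℝ) : ℂ) • cauchyVec t t' ψ s

namespace IsBandlimitPair

variable (h : IsBandlimitPair F t t')
include h

theorem eigenvector_node (ψ : HilbertBasis F ℂ H) (m : F) :
    eigenvector t t' ψ (t m) = (((-1 : ℝ) ^ (m : ℤ) : ℝ) : ℂ) • ψ m := by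
  have hex : ∃ k, t k = t m := ⟨m, rfl⟩
  have e : hex.choose = m := h.strictMono.injective hex.choose_spec
  rw [eigenvector, dif_pos hex, e, h.nodeIndex_node]

omit h in
theorem _root_.BandlimitModel.eigenvector_of_ne (ψ : HilbertBasis F ℂ H) {s : ℝ}
    (hs : ∀ m, t m ≠ s) : eigenvector t t' ψ s =
      (((-1 : ℝ) ^ nodeIndex t s * weight t t' s : ℝ) : ℂ) • cauchyVec t t' ψ s := by
  rw [eigenvector, dif_neg (not_exists.2 hs)]

theorem norm_eigenvector (ψ : HilbertBasis F ℂ H) (s : ℝ) : ‖eigenvector t t' ψ s‖ = 1 := by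
  by_cases hs : ∃ m, t m = s
  · obtain ⟨m, rfl⟩ := hs
    rw [h.eigenvector_node, norm_smul, ψ.orthonormal.1, Complex.norm_real, norm_zpow, norm_neg,
      norm_one, one_zpow, one_mul]
  · push Not at hs
    rw [eigenvector_of_ne ψ hs, norm_smul, Complex.norm_real, norm_mul, norm_zpow, norm_neg,
      norm_one, one_zpow, one_mul, h.weight_eq ψ, norm_inv, norm_norm,
      inv_mul_cancel₀ (norm_ne_zero_iff.2 (h.cauchyVec_ne_zero ψ hs))]

theorem hasEigenCoords_eigenvector (ψ : HilbertBasis F ℂ H) (s : ℝ) :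
    HasEigenCoords t t' ψ s (eigenvector t t' ψ s) := by
  by_cases hs : ∃ m, t m = s
  · obtain ⟨m, rfl⟩ := hs
    rw [h.eigenvector_node]
    exact hasEigenCoords_smul_basis m _
  · push Not at hs
    rw [eigenvector_of_ne ψ hs]
    exact hasEigenCoords_smul_cauchyVec h hs _

theorem im_repr_eigenvector (ψ : HilbertBasis F ℂ H) (s : ℝ) (n : F) :
    (ψ.repr (eigenvector t t' ψ s) n).im = 0 := by
  by_cases hs : ∃ m, t m = s
  · obtain ⟨m, rfl⟩ := hs
    rw [h.eigenvector_node, ψ.repr_smul, Complex.im_ofReal_mul]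
    by_cases hn : n = m
    · rw [hn, ψ.repr_basis_self, Complex.one_im, mul_zero]
    · rw [ψ.repr_basis_of_ne hn, Complex.zero_im, mul_zero]
  · push Not at hs
    rw [eigenvector_of_ne ψ hs, ψ.repr_smul, h.repr_cauchyVec, Complex.im_ofReal_mul,
      ← Complex.ofReal_sub, ← Complex.ofReal_div, Complex.ofReal_im, mul_zero]

theorem im_inner_eigenvector (ψ : HilbertBasis F ℂ H) (r s : ℝ) :
    (inner ℂ (eigenvector t t' ψ r) (eigenvector t t' ψ s) : ℂ).im = 0 := by
  have h1 := Complex.imCLM.hasSum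
    (ψ.hasSum_conj_repr_mul_repr (eigenvector t t' ψ r) (eigenvector t t' ψ s))
  refine h1.unique ((hasSum_zero (β := F)).congr_fun fun n => ?_)
  rw [Complex.imCLM_apply, Complex.mul_im, Complex.conj_im, h.im_repr_eigenvector,
    h.im_repr_eigenvector]
  ring

theorem inner_eigenvector (ψ : HilbertBasis F ℂ H) {r s : ℝ} (hr : ∀ m, t m ≠ r)
    (hs : ∀ m, t m ≠ s) :
    (inner ℂ (eigenvector t t' ψ r) (eigenvector t t' ψ s) : ℂ) =
      ((weight t t' r * (-1) ^ nodeIndex t r * (∑' k, t' k / ((r - t k) * (s - t k))) *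
        ((-1) ^ nodeIndex t s * weight t t' s) : ℝ) : ℂ) := by
  have e : (inner ℂ (cauchyVec t t' ψ r) (cauchyVec t t' ψ s) : ℂ) =
      ((∑' k, t' k / ((r - t k) * (s - t k)) : ℝ) : ℂ) := by
    rw [← (ψ.hasSum_conj_repr_mul_repr _ _).tsum_eq, Complex.ofReal_tsum]
    refine tsum_congr fun n => ?_
    rw [h.repr_cauchyVec, h.repr_cauchyVec, ← Complex.ofReal_sub, ← Complex.ofReal_sub,
      ← Complex.ofReal_div, ← Complex.ofReal_div, Complex.conj_ofReal, ← Complex.ofReal_mul,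
      div_mul_div_comm, Real.mul_self_sqrt (h.pos n).le]
  rw [eigenvector_of_ne ψ hr, eigenvector_of_ne ψ hs, inner_smul_left, inner_smul_right,
    Complex.conj_ofReal, e]
  push_cast
  ring

/-- A vector with the coordinates of `(s - tₘ) ∑ √t'ₙ / (s - tₙ) ψₙ` (with the removable singularity
at `tₘ` removed) gives the eigenvector upon normalization. -/
theorem eigenvector_eq_normalize (ψ : HilbertBasis F ℂ H) {s : ℝ} {m : F}
    (hne : ∀ n, n ≠ m → t n ≠ s) (hge : t m ≤ s → nodeIndex t s = m)
    (hlt : s < t m → nodeIndex t s = m - 1) {v : H}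
    (hv : ∀ n, ψ.repr v n = if n = m then (Real.sqrt (t' m) : ℂ) else
      ((s : ℂ) - t m) * (Real.sqrt (t' n) / ((s : ℂ) - t n))) :
    eigenvector t t' ψ s = ((-1 : ℝ) ^ (m : ℤ) * ‖v‖⁻¹) • v := by
  rw [← Complex.coe_smul]
  have hsm := Real.sqrt_pos.2 (h.pos m)
  by_cases hs : t m = s
  · subst hs
    have e : v = (Real.sqrt (t' m) : ℂ) • ψ m := by
      refine ψ.ext_repr fun n => ?_
      rw [hv, ψ.repr_smul]
      by_cases hn : n = m
      · rw [if_pos hn, hn, ψ.repr_basis_self, mul_one]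
      · rw [if_neg hn, ψ.repr_basis_of_ne hn, sub_self, zero_mul, mul_zero]
    have en : ‖v‖ = Real.sqrt (t' m) := by
      rw [e, norm_smul, ψ.orthonormal.1, mul_one, Complex.norm_real, Real.norm_eq_abs,
        abs_of_pos hsm]
    rw [h.eigenvector_node, en, e, smul_smul, ← Complex.ofReal_mul, mul_assoc,
      inv_mul_cancel₀ hsm.ne', mul_one]
  · have hs' : ∀ n, t n ≠ s := fun n => by
      by_cases hn : n = m
      · rw [hn]; exact hs
      · exact hne n hn
    have e : v = ((s - t m : ℝ) : ℂ) • cauchyVec t t' ψ s := by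
      refine ψ.ext_repr fun n => ?_
      rw [hv, ψ.repr_smul, h.repr_cauchyVec, Complex.ofReal_sub]
      by_cases hn : n = m
      · have := ofReal_sub_ne_zero hs
        rw [if_pos hn, hn]
        field_simp
      · rw [if_neg hn]
    have en : ‖v‖ = |s - t m| * ‖cauchyVec t t' ψ s‖ := by
      rw [e, norm_smul, Complex.norm_real, Real.norm_eq_abs]
    rw [eigenvector_of_ne ψ hs', en, e, smul_smul, ← Complex.ofReal_mul, h.weight_eq ψ]
    congr 2
    -- Normalizing leaves the sign of $s-t_m$; to the left of $t_m$ this is $-1$, matching the drop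
    -- of the node index to $m-1$.
    rcases lt_or_gt_of_ne hs with hlt' | hgt'
    · have := sub_pos.2 hlt'
      rw [hge hlt'.le, abs_of_pos this]
      field_simp
    · have := sub_neg.2 hgt'
      rw [hlt hgt', abs_of_neg this, zpow_sub_one₀ (by norm_num)]
      have h2 : -(s - t m) ≠ 0 := by linarith
      have h3 : s - t m ≠ 0 := this.ne
      field_simp

/-- Near $s_0$ only the term at $t_m$ can be singular. The rest of $g_s$ is $(1+(s-s_0)R)^{-1}G_0$
with $R$ bounded, and inversion is smooth on the units of the Banach algebra of operators. -/
theorem contDiff_eigenvector [CompleteSpace H] (ψ : HilbertBasis F ℂ H) :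
    ContDiff ℝ ∞ (eigenvector t t' ψ) := by
  rw [contDiff_iff_contDiffAt]
  intro s₀
  obtain ⟨m, hm, hev⟩ := h.exists_local_node s₀
  obtain ⟨δ, hδ, hgap⟩ := h.exists_gap s₀
  classical
  obtain ⟨R, hR⟩ := ψ.exists_diagonal (fun n => if n = m then 0 else ((s₀ : ℂ) - t n)⁻¹)
    (C := δ⁻¹) fun n => by
      by_cases hn : n = m
      · rw [if_pos hn, norm_zero]; positivity
      · rw [if_neg hn, norm_inv, ← Complex.ofReal_sub, Complex.norm_real, Real.norm_eq_abs]
        exact inv_anti₀ hδ (hgap n (hm n hn))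
  set G₀ : H := cauchyVec t t' ψ s₀ - ψ.repr (cauchyVec t t' ψ s₀) m • ψ m with hG₀
  have hG₀n : ∀ n, ψ.repr G₀ n =
      if n = m then 0 else (Real.sqrt (t' n) : ℂ) / ((s₀ : ℂ) - t n) := fun n => by
    rw [hG₀, ψ.repr_sub, ψ.repr_smul]
    by_cases hn : n = m
    · rw [if_pos hn, hn, ψ.repr_basis_self, mul_one, sub_self]
    · rw [if_neg hn, ψ.repr_basis_of_ne hn, mul_zero, sub_zero, h.repr_cauchyVec]
  let A : ℝ → (H →L[ℂ] H) := fun s => 1 + (s - s₀) • R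
  have hA : ContDiff ℝ ∞ A :=
    contDiff_const.add ((contDiff_id.sub contDiff_const).smul contDiff_const)
  have hA0 : A s₀ = 1 := by simp [A]
  have hAunit : ∀ᶠ s in nhds s₀, IsUnit (A s) := by
    refine hA.continuous.continuousAt.eventually_mem (Units.isOpen.mem_nhds ?_)
    rw [hA0]; exact isUnit_one
  -- This is $(s-t_m)g_s$ continued across $t_m$. Its $m$th coordinate is the constant
  -- $\sqrt{t_m'}\ne0$, so normalizing stays smooth.
  let v : ℝ → H := fun s => Real.sqrt (t' m) • ψ m + (s - t m) • (Ring.inverse (A s) G₀)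
  have hv : ∀ s, IsUnit (A s) → (∀ n, n ≠ m → t n ≠ s) → ∀ n, ψ.repr (v s) n =
      if n = m then (Real.sqrt (t' m) : ℂ) else
        ((s : ℂ) - t m) * (Real.sqrt (t' n) / ((s : ℂ) - t n)) := by
    intro s hs hne n
    have h1 : A s (Ring.inverse (A s) G₀) = G₀ := by
      have := Ring.mul_inverse_cancel _ hs
      exact congrArg (fun B : H →L[ℂ] H => B G₀) this
    have h2 := congrArg (fun x => ψ.repr x n) h1
    have h3 : ∀ x, A s x = x + ((s - s₀ : ℝ) : ℂ) • R x := fun x => by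
      rw [Complex.coe_smul]; rfl
    simp only [h3, ψ.repr_add, ψ.repr_smul, hR, hG₀n] at h2
    have h4 : v s = (Real.sqrt (t' m) : ℂ) • ψ m +
        ((s - t m : ℝ) : ℂ) • (Ring.inverse (A s) G₀) := by
      rw [Complex.coe_smul, Complex.coe_smul]
    rw [h4, ψ.repr_add, ψ.repr_smul, ψ.repr_smul]
    by_cases hn : n = m
    · simp only [if_pos hn, zero_mul, mul_zero, add_zero] at h2
      rw [if_pos hn, h2, hn, ψ.repr_basis_self, mul_one, mul_zero, add_zero]
    · simp only [if_neg hn] at h2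
      rw [if_neg hn, ψ.repr_basis_of_ne hn, mul_zero, zero_add, Complex.ofReal_sub]
      congr 1
      have e1 := ofReal_sub_ne_zero (hm n hn)
      have e2 := ofReal_sub_ne_zero (hne n hn)
      push_cast at h2
      rw [eq_div_iff e2]
      field_simp at h2
      linear_combination h2
  have hvs : ContDiffAt ℝ ∞ v s₀ := by
    have h1 : ContDiffAt ℝ ∞ (fun s => Ring.inverse (A s)) s₀ := by
      have h2 : ContDiffAt ℝ ∞ Ring.inverse (A s₀) := by
        rw [hA0]
        exact contDiffAt_ringInverse ℝ (1 : (H →L[ℂ] H)ˣ)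
      exact h2.comp s₀ hA.contDiffAt
    have h2 : ContDiffAt ℝ ∞ (fun s => Ring.inverse (A s) G₀) s₀ :=
      ((ContinuousLinearMap.apply ℂ H G₀).restrictScalars ℝ).contDiff.contDiffAt.comp s₀ h1
    exact contDiffAt_const.add ((contDiffAt_id.sub contDiffAt_const).smul h2)
  have hv0 : v s₀ ≠ 0 := fun hz => by
    have := hv s₀ (by rw [hA0]; exact isUnit_one) hm m
    rw [hz, ψ.repr_zero, if_pos rfl] at this
    exact h.sqrt_ne_zero m this.symm
  have hgoal : ContDiffAt ℝ ∞ (fun s => ((-1 : ℝ) ^ (m : ℤ) * ‖v s‖⁻¹) • v s) s₀ :=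
    (contDiffAt_const.mul ((hvs.norm ℂ hv0).inv (norm_ne_zero_iff.2 hv0))).smul hvs
  refine hgoal.congr_of_eventuallyEq ?_
  filter_upwards [hev, hAunit] with s hs hsu
  exact h.eigenvector_eq_normalize ψ hs.1 hs.2.1 hs.2.2 (hv s hsu hs.1)

end IsBandlimitPair

theorem IsNodeRestriction.hasKernelFormula [CompleteSpace H] (hT : IsNodeRestriction t ψ φp T)
    (h : IsBandlimitPair F t t')
    (hp : ∀ n, ψ.repr φp n = Real.sqrt (t' n) / ((t n : ℂ) - Complex.I))
    (hm : ∀ n, ψ.repr φm n = Real.sqrt (t' n) / ((t n : ℂ) + Complex.I)) :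
    HasKernelFormula t t' T φp φm (eigenvector t t' ψ) where
  smooth := ((h.contDiff_eigenvector ψ).comp contDiff_fst).inner ℂ
    ((h.contDiff_eigenvector ψ).comp contDiff_snd)
  real := h.im_inner_eigenvector ψ
  formula := fun r s hr hs => by
    rw [hT.floor_phase h hp hm, hT.floor_phase h hp hm]
    exact h.inner_eigenvector ψ (fun m hm => hr ⟨m, hm⟩) (fun m hm => hs ⟨m, hm⟩)

/-! ### The functional model -/

/-- The members at the nodes already suffice: $\phi_{t_n}$ is a nonzero multiple of $\psi_n$. -/
theorem HasEigenCoords.eq_zero_of_forall_inner_eq_zero (h : IsBandlimitPair F t t') {φ : ℝ → H}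
    (hφ : ∀ s, ‖φ s‖ = 1 ∧ HasEigenCoords t t' ψ s (φ s)) {x : H}
    (hx : ∀ s, (inner ℂ (φ s) x : ℂ) = 0) : x = 0 := by
  refine ψ.ext_repr fun n => ?_
  obtain ⟨hn, hc⟩ := hφ (t n)
  have e := hc.eq_smul_basis h
  have hne : ψ.repr (φ (t n)) n ≠ 0 := fun hz => by
    rw [e, hz, zero_smul, norm_zero] at hn
    exact zero_ne_one hn
  have := hx (t n)
  rw [e, inner_smul_left, ← ψ.repr_apply_apply] at this
  rw [ψ.repr_zero]
  exact (mul_eq_zero.1 this).resolve_left (by simpa using hne)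

theorem pointEval_inner (φ : ℝ → H) (s : ℝ) (f : LocalBandlimitSpace φ) :
    (inner ℂ (pointEval φ s) f : ℂ) = f s := by
  rw [pointEval, RKHS.kerFun_inner]
  simp

theorem inner_pointEval_pointEval (φ : ℝ → H) (r s : ℝ) :
    (inner ℂ (pointEval φ r) (pointEval φ s) : ℂ) = inner ℂ (φ r) (φ s) := by
  rw [pointEval_inner, pointEval, RKHS.kerFun_apply, RKHS.OfKernel.kernel_ofKernel]
  simp [gramKernel]

theorem exists_functionalModel [CompleteSpace H] {φ : ℝ → H}
    (hφ : ∀ x, (∀ s, (inner ℂ (φ s) x : ℂ) = 0) → x = 0) :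
    ∃ U : H ≃ₗᵢ[ℂ] LocalBandlimitSpace φ, ∀ s, U (φ s) = pointEval φ s :=
  exists_linearIsometryEquiv_of_gram hφ
    (fun f hf => RKHS.ext fun s => by
      rw [← pointEval_inner, hf, RKHS.coe_zero, Pi.zero_apply])
    fun r s => (inner_pointEval_pointEval φ r s).symm

theorem domain_unitaryConj {K : Type*} [NormedAddCommGroup K] [InnerProductSpace ℂ K]
    (U : H ≃ₗᵢ[ℂ] K) (T : H →ₗ.[ℂ] H) :
    (unitaryConj U T).domain = T.domain.map (U.toLinearEquiv : H →ₗ[ℂ] K) :=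
  (Submodule.map_equiv_eq_comap_symm U.toLinearEquiv T.domain).symm

end BandlimitModel

theorem mainTheorem3 {H : Type*} [NormedAddCommGroup H] [InnerProductSpace ℂ H] [CompleteSpace H]
    (F : Set ℤ) (t t' : F → ℝ) (hpair : IsBandlimitPair F t t')
    (T₀ : H →ₗ.[ℂ] H) (hT₀ : IsSelfAdjoint T₀)
    (ψ : HilbertBasis F ℂ H) (hψ : ∀ n, (ψ n, (t n : ℂ) • ψ n) ∈ T₀.graph)
    (φp φm : H) (hφp : φp = phiPlus t t' ψ) (hφm : φm = phiMinus t t' ψ)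
    (T : H →ₗ.[ℂ] H) (hT : T = symRestrict T₀ φp) :
    IsSR T ∧
    (∃ φ : ℝ → H, IsEigenvectorFamily t T φp φm φ ∧ HasKernelFormula t t' T φp φm φ) ∧
    ∀ φ : ℝ → H, IsEigenvectorFamily t T φp φm φ →
      ∃ U : H ≃ₗᵢ[ℂ] LocalBandlimitSpace φ,
        (∀ s : ℝ, U (φ s) = pointEval φ s) ∧
        (∀ W : H →L[ℂ] LocalBandlimitSpace φ, (∀ s : ℝ, W (φ s) = pointEval φ s) →
          ∀ h : H, W h = U h) ∧
        (∀ (h : H) (s : ℝ), (U h) s = inner ℂ (φ s) h) ∧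
        IsSR (unitaryConj U T) ∧
        (unitaryConj U T).domain = T.domain.map (U.toLinearEquiv : H →ₗ[ℂ] LocalBandlimitSpace φ) ∧
        ∀ (x : (unitaryConj U T).domain) (s : ℝ),
          (unitaryConj U T x) s = (s : ℂ) * (x : LocalBandlimitSpace φ) s := by
  subst hT
  have hp : ∀ n, ψ.repr φp n = Real.sqrt (t' n) / ((t n : ℂ) - Complex.I) :=
    fun n => hφp ▸ hpair.repr_phiPlus ψ n
  have hm : ∀ n, ψ.repr φm n = Real.sqrt (t' n) / ((t n : ℂ) + Complex.I) :=
    fun n => hφm ▸ hpair.repr_phiMinus ψ n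
  clear hφp hφm
  have hT := isNodeRestriction_symRestrict hT₀ hψ φp
  refine ⟨hT.isSR hp hpair, ⟨eigenvector t t' ψ, ?_, hT.hasKernelFormula hpair hp hm⟩, ?_⟩
  · exact (hT.isEigenvectorFamily_iff hpair hp hm).2 fun s =>
      ⟨hpair.norm_eigenvector ψ s, hpair.hasEigenCoords_eigenvector ψ s⟩
  · intro φ hφ
    rw [hT.isEigenvectorFamily_iff hpair hp hm] at hφ
    have htot : ∀ x, (∀ s, (inner ℂ (φ s) x : ℂ) = 0) → x = 0 := fun x hx =>
      HasEigenCoords.eq_zero_of_forall_inner_eq_zero hpair hφ hx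
    obtain ⟨U, hU⟩ := exists_functionalModel htot
    have hUeval : ∀ (h : H) (s : ℝ), (U h) s = inner ℂ (φ s) h := fun h s => by
      rw [← pointEval_inner, ← hU, U.inner_map_map]
    refine ⟨U, hU, fun W hW h => ?_, hUeval, ?_, domain_unitaryConj U _, fun x s => ?_⟩
    · refine congrFun (DenseRange.equalizer (denseRange_linearCombination htot)
        W.continuous U.continuous (funext fun c => ?_)) h
      simp [Finsupp.linearCombination_apply, Finsupp.sum, map_sum, hW, hU]
    · exact (hT.unitaryConj U).isSR
        (fun n => by rw [ψ.repr_mapIsometryEquiv_map]; exact hp n) hpair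
    · obtain ⟨c, hc⟩ := (hφ s).2
      have hmem := (mem_graph_unitaryConj U (symRestrict T₀ φp)).1
        ((unitaryConj U (symRestrict T₀ φp)).mem_graph x)
      -- Orthogonality of $\phi_s$ to $\operatorname{ran}(T-s)$ becomes, after turning inner
      -- products with $\phi_s$ into values at $s$, multiplication by the variable.
      have h0 := hT.inner_eq_zero hp hc hmem
      rw [inner_sub_right, inner_smul_right, ← hUeval, ← hUeval, U.apply_symm_apply,
        U.apply_symm_apply] at h0
      exact sub_eq_zero.1 h0
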